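/- \textbf{Theorem (random coding error).} Let $1\le n_R\le n_T$ and $l\ge 1$ be integers and consider the block channel $\mathbf Y=\mathbf H\mathbf X+\mathbf Z$ with $\mathbf X\in\mathbb R_+^{n_T\times l}$ and $\mathbf H\in\mathbb R_+^{n_R\times n_T}$, where $\mathbf Z\in\mathbb R^{n_R\times l}$ has i.i.d. $\mathcal N(0,\sigma_n^2)$ entries, $\sigma_n>0$ fixed. The matrix $\mathbf H$ is independent of $\mathbf X,\mathbf Z$ and known to the receiver; its entries are $h_{ij}=e^{-\nu d_{ij}}h^r_{ij}$ with fixed real $\nu,d_{ij}$ and i.i.d. $h^r_{ij}$ having on $(0,\infty)$ one of the densities $e^{-x}$ (negative exponential); $\frac{2(\rho_1\rho_2)^{(\rho_1+\rho_2)/2}}{\Gamma(\rho_1)\Gamma(\rho_2)}x^{\frac{\rho_1+\rho_2}{2}-1}K_{\rho_1-\rho_2}(2\sqrt{\rho_1\rho_2x})$ with $0<\rho_2<\rho_1$ and $K$ the modified Bessel function of the second kind (gamma-gamma); or $\frac{1}{x\sqrt{2\pi\sigma_l^2}}e^{-(\log x-\mu_l)^2/(2\sigma_l^2)}$ with $\sigma_l>0$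 (log-normal). The average power is $\mathcal E$, the peak power per transmitter is $\mathsf A=\mathcal E/\alpha$ with $\alpha\in(0,n_T/2]$ fixed, and $\rho=\mathsf{OSNR}=\mathcal E/\sigma_n$ tends to infinity. Let $r\ge0$ and let $R=r\log\rho$ (nats per channel use). Let $\mathrm P_{\rm out}(\rho)=\inf_p \mathrm P[I_p(\mathbf H)\le R]$, where $I_p(\mathrm H)$ is the mutual information between one input column $X\sim p$ and the corresponding output column $\mathrm HX+Z$, and the infimum is over all laws $p$ on $[0,\mathsf A]^{n_T}$ with $\mathbb E\|X\|_1\le\mathcal E$. Let the truncated exponential law on $[0,\mathsf A]$ have density $\frac1{\mathsf A}\frac{\mu}{1-e^{-\mu}}e^{-\mu x/\mathsf A}$, where $\frac1\mu-\frac{e^{-\mu}}{1-e^{-\mu}}=\frac{\alpha}{n_T}$ (for $\alpha=n_T/2$: $\mu=0$, the uniform law), and let $\mathcal C=\{\mathrm H: I_{\rm te}(\mathrm H)<R\}$ be the outage set of the input whose $n_T$ entries are i.i.d. with this law. Write the eigenvalues of $\mathbf H\mathbf H^{T}$ as $\lambda_i=\rho^{-a_i}$, $1\le i\le n_R$, let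 $f(a)$ denote the distribution of $a=(a_1,\dots,a_{n_R})$, and put $x^+=\max\{0,x\}$, \[ J(\rho)=\int_{\mathcal C^c} f(a)\,\rho^{-\frac l2\left(\sum_{i=1}^{n_R}(2-a_i)^+-2r\right)}\,da:=\mathbb E\Big[\mathbf 1_{\{\mathbf H\notin\mathcal C\}}\,\rho^{-\frac l2\left(\sum_{i=1}^{n_R}(2-a_i)^+-2r\right)}\Big]. \] Let $\mathrm P_{\rm e}(\rho)$ be the error probability, averaged over a uniform message, the channel, the noise and the code, of a random code with $\lceil\rho^{lr}\rceil$ codewords in $\mathbb R_+^{n_T\times l}$, all of whose entries are i.i.d. truncated exponential, under maximum-likelihood decoding with any tie-breaking rule. Then, with $\log 0=-\infty$, \[\limsup_{\rho\to\infty}\frac{\log \mathrm P_{\rm e}(\rho)}{\log\rho}\le\limsup_{\rho\to\infty}\frac{\log(\mathrm P_{\rm out}(\rho)+J(\rho))}{\log\rho}.\] In particular, whenever the limits (possibly $+\infty$) $d_{\rm out}(r)=-\lim_{\rho\to\infty}\frac{\log \mathrm P_{\rm out}(\rho)}{\log\rho}$ and $d_{\rm te}(r)=-\lim_{\rho\to\infty}\frac{\log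 J(\rho)}{\log\rho}$ exist, that is, $\mathrm P_{\rm out}(\rho)\doteq\rho^{-d_{\rm out}(r)}$ and $J(\rho)\doteq\rho^{-d_{\rm te}(r)}$, we have \[\mathrm P_{\rm e}(\rho)\ \dot\leqslant\ \rho^{-d_{\rm out}(r)}+\rho^{-d_{\rm te}(r)},\] where $F\,\dot\leqslant\,G$ means $\limsup_{\rho\to\infty}\frac{\log F(\rho)}{\log\rho}\le\liminf_{\rho\to\infty}\frac{\log G(\rho)}{\log\rho}$ (and $\rho^{-\infty}=0$). -/

import Mathlib

open MeasureTheory ProbabilityTheory Filter Topology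
open scoped NNReal ENNReal

namespace OWC

noncomputable section

/-- Modified Bessel function of the second kind `K_τ(x)`, for `x > 0`. -/
def besselK (τ x : ℝ) : ℝ :=
  ∫ t in Set.Ioi (0 : ℝ), Real.exp (-x * Real.cosh t) * Real.cosh (τ * t)

/-- The three models of the random atmospheric turbulence intensity. -/
inductive Turbulence where
  | negExp
  | gammaGamma (ρ₁ ρ₂ : ℝ) (pos : 0 < ρ₂) (lt : ρ₂ < ρ₁)
  | logNormal (μl σl : ℝ) (pos : 0 < σl)

/-- Density of the turbulence intensity on `(0, ∞)`. -/
def Turbulence.pdf : Turbulence → ℝ → ℝ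
  | .negExp, x => Real.exp (-x)
  | .gammaGamma ρ₁ ρ₂ _ _, x =>
      2 * (ρ₁ * ρ₂) ^ ((ρ₁ + ρ₂) / 2) / (Real.Gamma ρ₁ * Real.Gamma ρ₂)
        * x ^ ((ρ₁ + ρ₂) / 2 - 1) * besselK (ρ₁ - ρ₂) (2 * Real.sqrt (ρ₁ * ρ₂ * x))
  | .logNormal μl σl _, x =>
      1 / (x * Real.sqrt (2 * Real.pi * σl ^ 2))
        * Real.exp (-(Real.log x - μl) ^ 2 / (2 * σl ^ 2))

/-- Law of the turbulence intensity. -/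
def Turbulence.law (t : Turbulence) : Measure ℝ :=
  (volume.restrict (Set.Ioi 0)).withDensity fun x => ENNReal.ofReal (t.pdf x)

/-- The fixed parameters of the channel `Y = H X + Z` with `nT` transmitters and `nR` receivers:
turbulence model, attenuation parameter `ν`, distances `d i j`, noise standard deviation `σ`, and
ratio `α` of the average power to the peak power. -/
structure Channel (nR nT : ℕ) where
  turbulence : Turbulence
  ν : ℝ
  d : Fin nR → Fin nT → ℝ
  σ : ℝ≥0
  σ_pos : 0 < σ
  α : ℝ
  α_pos : 0 < α
  α_le : α ≤ (nT : ℝ) / 2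

variable {nR nT : ℕ}

/-- Law of the channel matrix `H`: independent entries `h i j = exp (-ν d i j) * hr i j`, the
`hr i j` being i.i.d. with the turbulence law. -/
def Channel.lawH (c : Channel nR nT) : Measure (Fin nR → Fin nT → ℝ) :=
  Measure.pi fun i => Measure.pi fun j =>
    c.turbulence.law.map fun x => Real.exp (-(c.ν * c.d i j)) * x

/-- Allowed total average power at optical signal-to-noise ratio `ρ` (which is `𝓔 / σ`). -/
def Channel.avgPower (c : Channel nR nT) (ρ : ℝ) : ℝ := ρ * c.σ

/-- Allowed peak power of each transmitter at optical signal-to-noise ratio `ρ`. -/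
def Channel.peak (c : Channel nR nT) (ρ : ℝ) : ℝ := c.avgPower ρ / c.α

/-- Law of an `nR × l` array of i.i.d. centred Gaussian noise samples of variance `σ ^ 2`. -/
def Channel.noise (c : Channel nR nT) (l : ℕ) : Measure (Fin nR → Fin l → ℝ) :=
  Measure.pi fun _ => Measure.pi fun _ => gaussianReal 0 (c.σ ^ 2)

/-- Law of the noise vector at one time index. -/
def Channel.noiseVec (c : Channel nR nT) : Measure (Fin nR → ℝ) :=
  Measure.pi fun _ => gaussianReal 0 (c.σ ^ 2)

/-- Input laws of one column satisfying nonnegativity and the peak- and average-power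
constraints. -/
structure Channel.Admissible (c : Channel nR nT) (ρ : ℝ) (p : Measure (Fin nT → ℝ)) : Prop where
  prob : IsProbabilityMeasure p
  peak : ∀ᵐ x ∂p, ∀ i, 0 ≤ x i ∧ x i ≤ c.peak ρ
  average : ∫ x, ∑ i, x i ∂p ≤ c.avgPower ρ

/-- Joint law of `(X, H X + Z)` at one time index, for a fixed channel matrix `H` and input
law `p`. -/
def Channel.jointXY (c : Channel nR nT) (p : Measure (Fin nT → ℝ)) (H : Fin nR → Fin nT → ℝ) :
    Measure ((Fin nT → ℝ) × (Fin nR → ℝ)) :=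
  (p.prod c.noiseVec).map fun xz => (xz.1, (Matrix.of H).mulVec xz.1 + xz.2)

/-- Mutual information `I(X; Y | H)` in nats, for a fixed channel matrix `H` and input law `p`. -/
def Channel.mutualInfo (c : Channel nR nT) (p : Measure (Fin nT → ℝ))
    (H : Fin nR → Fin nT → ℝ) : ℝ≥0∞ :=
  InformationTheory.klDiv (c.jointXY p H) ((c.jointXY p H).fst.prod (c.jointXY p H).snd)

/-- Target rate `R = r log ρ`, in nats per channel use. -/
def rate (r ρ : ℝ) : ℝ≥0∞ := ENNReal.ofReal (r * Real.log ρ)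

/-- Outage probability: the infimum, over all admissible input laws, of `P[I(X; Y | H) ≤ R]`. -/
def Channel.Pout (c : Channel nR nT) (r ρ : ℝ) : ℝ≥0∞ :=
  ⨅ (p : Measure (Fin nT → ℝ)) (_ : c.Admissible ρ p), c.lawH {H | c.mutualInfo p H ≤ rate r ρ}

/-- Mean of the truncated exponential law on `[0, 1]` with parameter `m`; the value `1 / 2` at
`m = 0` is the continuous extension (uniform law). -/
def truncExpMean (m : ℝ) : ℝ :=
  if m = 0 then 1 / 2 else 1 / m - Real.exp (-m) / (1 - Real.exp (-m))

/-- Density of the truncated exponential law on `[0, A]` with parameter `m` (uniform if `m = 0`). -/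
def truncExpPDF (A m x : ℝ) : ℝ :=
  1 / A * (if m = 0 then 1 else m / (1 - Real.exp (-m))) * Real.exp (-(m * x / A))

/-- The truncated exponential law on `[0, A]` with parameter `m`. -/
def truncExp (A m : ℝ) : Measure ℝ :=
  (volume.restrict (Set.Icc 0 A)).withDensity fun x => ENNReal.ofReal (truncExpPDF A m x)

/-- Input law of one column under truncated exponential coding. -/
def Channel.teInput (c : Channel nR nT) (m ρ : ℝ) : Measure (Fin nT → ℝ) :=
  Measure.pi fun _ => truncExp (c.peak ρ) m

/-- Outage set `𝓒` of the truncated exponential scheme. -/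
def Channel.outageSet (c : Channel nR nT) (m r ρ : ℝ) : Set (Fin nR → Fin nT → ℝ) :=
  {H | c.mutualInfo (c.teInput m ρ) H < rate r ρ}

/-- The eigenvalues of `H Hᵀ` (they enter below only through symmetric expressions, so that their
order is immaterial). -/
def eig (H : Fin nR → Fin nT → ℝ) : Fin nR → ℝ :=
  (Matrix.isHermitian_mul_conjTranspose_self (Matrix.of H)).eigenvalues

/-- The exponents `a i`, given by `λ i = ρ ^ (-a i)`. -/
def expo (ρ : ℝ) (H : Fin nR → Fin nT → ℝ) (i : Fin nR) : ℝ := -Real.logb ρ (eig H i)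

/-- `∫_{𝓒ᶜ} f(a) ρ ^ (-(l/2) (∑ (2 - a i)⁺ - 2 r)) da`. Since `f(a) da` is the law of the vector
`a = a(H)`, and `𝓒` is a set of channel matrices, this is the integral over `H ∉ 𝓒`. -/
def Channel.teIntegral (c : Channel nR nT) (l : ℕ) (m r ρ : ℝ) : ℝ≥0∞ :=
  ∫⁻ H in (c.outageSet m r ρ)ᶜ,
    ENNReal.ofReal (ρ ^ (-((l : ℝ) / 2) * (∑ i, max 0 (2 - expo ρ H i) - 2 * r))) ∂c.lawH

/-- Number of codewords of a code of block length `l` and rate `r log ρ`: `ρ ^ (l r)`, rounded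
up. -/
def codeSize (l : ℕ) (r ρ : ℝ) : ℕ := max 1 ⌈ρ ^ ((l : ℝ) * r)⌉₊

/-- Law of the random codebook: the entries of all the `nT × l` codewords are i.i.d. truncated
exponential. -/
def Channel.codebook (c : Channel nR nT) (l : ℕ) (m r ρ : ℝ) :
    Measure (Fin (codeSize l r ρ) → Fin nT → Fin l → ℝ) :=
  Measure.pi fun _ => Measure.pi fun _ => Measure.pi fun _ => truncExp (c.peak ρ) m

/-- The noiseless output `H X`. -/
def output {l : ℕ} (H : Fin nR → Fin nT → ℝ) (X : Fin nT → Fin l → ℝ) : Fin nR → Fin l → ℝ :=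
  fun i j => (Matrix.of H * Matrix.of X) i j

/-- Likelihood of the received block `Y` when `X` is sent and the channel matrix is `H`. -/
def Channel.likelihood (c : Channel nR nT) {l : ℕ} (H : Fin nR → Fin nT → ℝ)
    (X : Fin nT → Fin l → ℝ) (Y : Fin nR → Fin l → ℝ) : ℝ :=
  ∏ i, ∏ j, gaussianPDFReal (output H X i j) (c.σ ^ 2) (Y i j)

/-- A decoder for `M` messages, which knows the channel matrix, the codebook and the received
block. -/
abbrev Decoder (nR nT l M : ℕ) : Type :=
  (Fin nR → Fin nT → ℝ) → (Fin M → Fin nT → Fin l → ℝ) → (Fin nR → Fin l → ℝ) → Fin M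

/-- Maximum-likelihood decoders (ties may be broken in any way). -/
def Channel.IsML (c : Channel nR nT) {l M : ℕ} (δ : Decoder nR nT l M) : Prop :=
  ∀ (H : Fin nR → Fin nT → ℝ) (X : Fin M → Fin nT → Fin l → ℝ) (Y : Fin nR → Fin l → ℝ) (k : Fin M),
    c.likelihood H (X k) Y ≤ c.likelihood H (X (δ H X Y)) Y

/-- Average error probability of the random code, for a uniformly distributed message: average over
the message, the channel matrix, the random codebook and the noise. -/
def Channel.Pe (c : Channel nR nT) (l : ℕ) (m r ρ : ℝ)
    (δ : Decoder nR nT l (codeSize l r ρ)) : ℝ≥0∞ :=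
  (∑ k, (c.lawH.prod ((c.codebook l m r ρ).prod (c.noise l)))
    {ω | δ ω.1 ω.2.1 (output ω.1 (ω.2.1 k) + ω.2.2) ≠ k}) / (codeSize l r ρ : ℝ≥0∞)

/-- `log g(ρ) / log ρ`, where `log 0 = -∞`. -/
def exponent (g : ℝ → ℝ≥0∞) (ρ : ℝ) : EReal := ENNReal.log (g ρ) / (Real.log ρ : EReal)

/-- `ρ ^ e` for an extended real exponent `e`, with `ρ ^ (-∞) = 0`. -/
def osnrPow (ρ : ℝ) (e : EReal) : ℝ≥0∞ := EReal.exp (e * (Real.log ρ : EReal))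

/-- Exponential equality `g(ρ) ≐ ρ ^ b` as `ρ → ∞`. -/
def ExpEq (g : ℝ → ℝ≥0∞) (b : EReal) : Prop := Tendsto (exponent g) atTop (𝓝 b)

/-- Exponential inequality `f ⩽ g` to first order in the exponent, as `ρ → ∞` (for `g ≐ ρ ^ b` it says that
`limsup log f / log ρ ≤ b`). -/
def ExpLE (f g : ℝ → ℝ≥0∞) : Prop :=
  limsup (exponent f) atTop ≤ liminf (exponent g) atTop

end

end OWC

/-! Everything is controlled by D(ρ, H) = det(1 + ρ² H Hᵀ) (`gramDet`). Up to additive constants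
independent of ρ and H, (1/2) log D is a lower bound for the mutual information of the truncated
exponential input (`le_mutualInfo_teInput`) and an upper bound for that of every admissible input
(`mutualInfo_le`). The lower bound is Donsker–Varadhan with the unnormalised log-likelihood as test
function. The upper bound dominates the joint law by a multiple, of order √D, of the product of the
input law and the output law of a Gaussian input.

The truncated exponential outage set therefore lies in S = {log D < 2(R + K₁)}, and the error
probability is at most P(S) plus a union bound over channels outside S. The Chernoff bound for one
pair of codewords is exp(-‖H(X - X')‖²/(8σ²)); averaging over X' column by column gives (C/√D)^l
(`codebook_pairwise_le`). Multiplied by the number of wrong codewords, at most ρ^(lr), this is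
bounded by a constant times the integrand of J, because 1 + ρ²λᵢ ≥ ρ^((2 - aᵢ)⁺) (`integrand_ge`).

It remains to compare P(S) with the optimal outage probability. The outage event of every admissible
p contains {(1/2) log D + K₂ ≤ R}, which differs from S by a constant in the threshold. Replacing H
by s⁻¹H with a small constant s closes that gap (`gramDet_mul_le`). Such a dilation changes the law
of H by at most a factor Cρ^δ, up to an error Cρ^(-N), for any δ, N > 0 (`lawH_dilation_le`). Hence
Pe ≤ Cρ^δ (Pout + J) + Cρ^(-N) for large ρ (`Pe_le_Pout_add`), and δ and N being arbitrary, the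
exponents compare, even if the right-hand exponent is -∞. -/

namespace OWC

/-! ### Product measures: densities, domination, transposition, generic linear independence -/

section ProductMeasures

/-- The integral of a product of functions of the single coordinates is the product of the
integrals. -/
theorem lintegral_pi_prod {n : ℕ} {E : Type*} [MeasurableSpace E]
    {μ : Fin n → Measure E} [∀ i, SigmaFinite (μ i)]
    {f : Fin n → E → ℝ≥0∞} (hf : ∀ i, Measurable (f i)) :
    ∫⁻ x, ∏ i, f i (x i) ∂(Measure.pi μ) = ∏ i, ∫⁻ x, f i x ∂(μ i) := by
  induction n with
  | zero => simp
  | succ n ih =>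
    rw [← ((measurePreserving_piFinSuccAbove μ 0).symm).lintegral_comp_emb
      (MeasurableEquiv.measurableEmbedding _)]
    simp_rw [MeasurableEquiv.piFinSuccAbove_symm_apply, Fin.insertNthEquiv, Fin.prod_univ_succ,
      Equiv.coe_fn_mk, Fin.insertNth_zero, Fin.cons_succ, Fin.cons_zero]
    have hm : Measurable fun y : Fin n → E => ∏ i, f i.succ (y i) :=
      Finset.measurable_prod _ fun i _ => (hf i.succ).comp (measurable_pi_apply i)
    have h := lintegral_prod_mul (μ := μ 0) (ν := Measure.pi fun j : Fin n => μ j.succ)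
      (hf 0).aemeasurable hm.aemeasurable
    rw [ih fun i => hf i.succ] at h
    exact h

theorem pi_withDensity {n : ℕ} {E : Type*} [MeasurableSpace E]
    {μ : Fin n → Measure E} [∀ i, SigmaFinite (μ i)]
    {f : Fin n → E → ℝ≥0∞} (hf : ∀ i, Measurable (f i))
    [∀ i, SigmaFinite ((μ i).withDensity (f i))] :
    Measure.pi (fun i => (μ i).withDensity (f i))
      = (Measure.pi μ).withDensity fun x => ∏ i, f i (x i) := by
  refine Measure.pi_eq fun s hs => ?_
  rw [withDensity_apply _ (.univ_pi hs), Measure.restrict_pi_pi, lintegral_pi_prod hf]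
  exact Finset.prod_congr rfl fun i _ => (withDensity_apply _ (hs i)).symm

theorem pi_absolutelyContinuous {n : ℕ} {E : Type*} [MeasurableSpace E]
    {μ ν : Fin n → Measure E} [∀ i, SigmaFinite (μ i)] [∀ i, SigmaFinite (ν i)]
    (h : ∀ i, μ i ≪ ν i) : Measure.pi μ ≪ Measure.pi ν := by
  have e : ∀ i, (ν i).withDensity ((μ i).rnDeriv (ν i)) = μ i := fun i =>
    Measure.withDensity_rnDeriv_eq _ _ (h i)
  have : ∀ i, SigmaFinite ((ν i).withDensity ((μ i).rnDeriv (ν i))) := fun i => by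
    rw [e]; infer_instance
  have := pi_withDensity (μ := ν) (f := fun i => (μ i).rnDeriv (ν i))
    fun i => Measure.measurable_rnDeriv _ _
  simp_rw [e] at this
  rw [this]
  exact withDensity_absolutelyContinuous _ _

/-- Domination on boxes does not by itself pass to all measurable sets. It does here because the
product outer measure is the largest one bounded on boxes by the products of the masses; the
constants are nonzero so that they can be moved to the left. -/
theorem pi_le_smul_pi {ι : Type*} [Fintype ι] {E : ι → Type*} {mE : ∀ i, MeasurableSpace (E i)}
    {μ ν : (i : ι) → Measure (E i)} [∀ i, SigmaFinite (μ i)] {c : ι → ℝ≥0}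
    (hc : ∀ i, c i ≠ 0) (h : ∀ i, μ i ≤ (c i : ℝ≥0∞) • ν i) :
    Measure.pi μ ≤ ((∏ i, c i : ℝ≥0) : ℝ≥0∞) • Measure.pi ν := by
  have h0 : ((∏ i, c i : ℝ≥0) : ℝ≥0∞) ≠ 0 := by
    simpa [Finset.prod_eq_zero_iff] using hc
  have key : ((∏ i, c i : ℝ≥0) : ℝ≥0∞)⁻¹ • (Measure.pi μ).toOuterMeasure
      ≤ OuterMeasure.pi fun i => (ν i).toOuterMeasure := by
    rw [OuterMeasure.le_pi]
    intro s _
    change ((∏ i, c i : ℝ≥0) : ℝ≥0∞)⁻¹ * Measure.pi μ (Set.univ.pi s) ≤ ∏ i, ν i (s i)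
    rw [Measure.pi_pi, ENNReal.inv_mul_le_iff h0 ENNReal.coe_ne_top, ENNReal.ofNNReal_finsetProd,
      ← Finset.prod_mul_distrib]
    exact Finset.prod_le_prod' fun i _ => h i (s i)
  refine Measure.le_iff.2 fun s hs => ?_
  have h1 := key s
  change ((∏ i, c i : ℝ≥0) : ℝ≥0∞)⁻¹ * Measure.pi μ s ≤ _ at h1
  rw [ENNReal.inv_mul_le_iff h0 ENNReal.coe_ne_top] at h1
  refine h1.trans ?_
  change _ ≤ ((∏ i, c i : ℝ≥0) : ℝ≥0∞) * Measure.pi ν s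
  gcongr
  rw [Measure.pi_def]
  exact le_toMeasure_apply _ _ _

/-- Interchanging the two indices of an array preserves the law of independent entries. -/
theorem map_swap_pi_pi {k l : ℕ} (μ : Fin k → Fin l → Measure ℝ)
    [∀ i j, IsProbabilityMeasure (μ i j)] :
    (Measure.pi fun i => Measure.pi fun j => μ i j).map (fun x j i => x i j)
      = Measure.pi fun j => Measure.pi fun i => μ i j := by
  have hm : Measurable fun (x : Fin k → Fin l → ℝ) j i => x i j := by fun_prop
  refine (Measure.pi_eq_generateFrom (C := fun _ => Set.univ.pi '' Set.univ.pi fun _ =>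
    {s : Set ℝ | MeasurableSet s}) (fun _ => generateFrom_pi) (fun _ => isPiSystem_pi)
    (fun j => ⟨fun _ => Set.univ, fun _ => ⟨fun _ => Set.univ, by simp, by simp⟩,
      fun _ => by simp, by simp [Set.iUnion_const]⟩) ?_).symm
  intro s hs
  choose t ht hts using hs
  obtain rfl : (fun j => Set.univ.pi (t j)) = s := funext hts
  have ht' : ∀ j i, MeasurableSet (t j i) := fun j i => ht j i (Set.mem_univ i)
  rw [Measure.map_apply hm (.univ_pi fun j => .univ_pi fun i => ht' j i)]
  have : (fun (x : Fin k → Fin l → ℝ) j i => x i j) ⁻¹'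
      Set.univ.pi (fun j => Set.univ.pi (t j)) = Set.univ.pi fun i => Set.univ.pi fun j => t j i := by
    ext x
    simp only [Set.mem_preimage, Set.mem_pi, Set.mem_univ, forall_true_left]
    exact forall_comm
  rw [this]
  simp only [Measure.pi_pi]
  exact Finset.prod_comm

/-- An integral against a product of probability measures is bounded by the supremum of the
integrals in one of the coordinates. -/
theorem lintegral_pi_le_of_forall_update {ι : Type*} [Fintype ι] [DecidableEq ι] {E : ι → Type*}
    {mE : ∀ i, MeasurableSpace (E i)} {μ : (i : ι) → Measure (E i)}
    [∀ i, IsProbabilityMeasure (μ i)] {f : (∀ i, E i) → ℝ≥0∞} (hf : Measurable f) (i : ι)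
    {B : ℝ≥0∞} (h : ∀ x, ∫⁻ y, f (Function.update x i y) ∂(μ i) ≤ B) :
    ∫⁻ x, f x ∂(Measure.pi μ) ≤ B := by
  refine (lintegral_le_of_lmarginal_le {i} hf (measurable_const (a := B)) ?_).trans_eq (by simp)
  intro x
  rw [lmarginal_singleton, lmarginal_singleton]
  simpa using h x

/-- Random vectors with independent absolutely continuous laws, at most as many as the dimension,
are almost surely linearly independent. -/
theorem ae_linearIndependent {n N : ℕ} (hn : n ≤ N) (ν : Fin n → Measure (Fin N → ℝ))
    [∀ i, SigmaFinite (ν i)] (hν : ∀ i, ν i ≪ volume) :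
    ∀ᵐ H ∂(Measure.pi ν), LinearIndependent ℝ H := by
  induction n with
  | zero => exact Eventually.of_forall fun H => linearIndependent_empty_type
  | succ n ih =>
    have mp := (measurePreserving_piFinSuccAbove ν 0).symm
    rw [← mp.map_eq, ae_map_iff mp.measurable.aemeasurable
      isOpen_setOfPred_linearIndependent.measurableSet]
    have hm : MeasurableSet {x : (Fin N → ℝ) × (Fin n → Fin N → ℝ) | LinearIndependent ℝ
        ((MeasurableEquiv.piFinSuccAbove (fun _ : Fin (n + 1) => Fin N → ℝ) 0).symm x)} :=
      (MeasurableEquiv.measurable _) isOpen_setOfPred_linearIndependent.measurableSet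
    -- Fix the last n rows first: their span is a proper subspace, hence null for the law of the
    -- first row.
    rw [← Measure.prod_swap, ae_map_iff measurable_swap.aemeasurable hm]
    refine (Measure.ae_prod_mem_iff_ae_ae_mem (measurable_swap hm)).2 ?_
    filter_upwards [ih (by omega) (fun j => ν (Fin.succAbove 0 j)) fun j => hν _] with v hv
    have hne : Submodule.span ℝ (Set.range v) ≠ ⊤ := by
      intro h
      have h1 := finrank_range_le_card (R := ℝ) v
      rw [Set.finrank, h, finrank_top] at h1
      simp at h1
      omega
    have h0 : ν 0 (Submodule.span ℝ (Set.range v) : Set (Fin N → ℝ)) = 0 :=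
      hν 0 (Measure.addHaar_submodule volume _ hne)
    filter_upwards [measure_eq_zero_iff_ae_notMem.1 h0] with x hx
    change LinearIndependent ℝ
        ((MeasurableEquiv.piFinSuccAbove (fun _ : Fin (n + 1) => Fin N → ℝ) 0).symm (x, v))
    have : (MeasurableEquiv.piFinSuccAbove (fun _ : Fin (n + 1) => Fin N → ℝ) 0).symm (x, v)
        = Fin.cons x v := by
      rw [MeasurableEquiv.piFinSuccAbove_symm_apply]
      simp [Fin.insertNthEquiv]
    rw [this, linearIndependent_finCons]
    exact ⟨hv, hx⟩

end ProductMeasures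

end OWC

/-! ### The determinant of 1 + ρ² H Hᵀ and its eigenvalue product -/

namespace OWC

open Matrix

/-- The square of the Euclidean norm. -/
noncomputable def normSq {n : ℕ} (v : Fin n → ℝ) : ℝ := v ⬝ᵥ v

theorem normSq_eq_sum {n : ℕ} (v : Fin n → ℝ) : normSq v = ∑ i, v i ^ 2 := by
  simp [normSq, dotProduct, sq]

theorem normSq_nonneg {n : ℕ} (v : Fin n → ℝ) : 0 ≤ normSq v := by
  rw [normSq_eq_sum]; positivity

theorem normSq_add {n : ℕ} (v w : Fin n → ℝ) :
    normSq (v + w) = normSq v + 2 * (v ⬝ᵥ w) + normSq w := by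
  simp only [normSq, add_dotProduct, dotProduct_add, dotProduct_comm w v]; ring

theorem normSq_sub {n : ℕ} (v w : Fin n → ℝ) :
    normSq (v - w) = normSq v - 2 * (v ⬝ᵥ w) + normSq w := by
  simp only [normSq, sub_dotProduct, dotProduct_sub, dotProduct_comm w v]; ring

@[fun_prop]
theorem continuous_normSq {n : ℕ} : Continuous (normSq : (Fin n → ℝ) → ℝ) := by
  simp_rw [show (normSq : (Fin n → ℝ) → ℝ) = fun v => ∑ i, v i ^ 2 from funext normSq_eq_sum]
  fun_prop

variable {nR nT : ℕ}

/-- The determinant of `1 + ρ² H Hᵀ`. -/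
noncomputable def gramDet (ρ : ℝ) (H : Fin nR → Fin nT → ℝ) : ℝ :=
  (1 + ρ ^ 2 • (of H * (of H)ᵀ)).det

/-- Sylvester's identity. The receiver-side form carries the eigenvalues; the transmitter-side form
is what Gaussian integrals over inputs produce. -/
theorem gramDet_eq (ρ : ℝ) (H : Fin nR → Fin nT → ℝ) :
    gramDet ρ H = (1 + ρ ^ 2 • ((of H)ᵀ * of H)).det := by
  rw [gramDet, ← smul_mul, det_one_add_mul_comm, Matrix.mul_smul]

/-- With such a B the form ‖u‖² + ρ²‖Hu‖² becomes ‖Bu‖², so its Gaussian integral is a linear change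
of variables. -/
theorem exists_factor (ρ : ℝ) (H : Fin nR → Fin nT → ℝ) :
    ∃ B : Matrix (Fin nT) (Fin nT) ℝ, Bᵀ * B = 1 + ρ ^ 2 • ((of H)ᵀ * of H) := by
  have h1 : (1 + ρ ^ 2 • ((of H)ᵀ * of H)).PosSemidef := by
    have := posSemidef_conjTranspose_mul_self (of H)
    rw [conjTranspose_eq_transpose_of_trivial] at this
    exact PosSemidef.one.add (this.smul (sq_nonneg ρ))
  open scoped MatrixOrder in
  obtain ⟨B, hB⟩ := CStarAlgebra.nonneg_iff_eq_star_mul_self.mp h1.nonneg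
  refine ⟨B, ?_⟩
  rw [hB, star_eq_conjTranspose, conjTranspose_eq_transpose_of_trivial]

theorem normSq_mulVec_factor {ρ : ℝ} {H : Fin nR → Fin nT → ℝ} {B : Matrix (Fin nT) (Fin nT) ℝ}
    (hB : Bᵀ * B = 1 + ρ ^ 2 • ((of H)ᵀ * of H)) (u : Fin nT → ℝ) :
    normSq (B *ᵥ u) = normSq u + ρ ^ 2 * normSq (of H *ᵥ u) := by
  have h : ∀ {k : ℕ} (A : Matrix (Fin k) (Fin nT) ℝ), normSq (A *ᵥ u) = u ⬝ᵥ ((Aᵀ * A) *ᵥ u) := by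
    intro k A
    rw [normSq, ← mulVec_mulVec, dotProduct_mulVec u, vecMul_transpose]
  rw [h B, hB, add_mulVec, one_mulVec, smul_mulVec, dotProduct_add, dotProduct_smul, h (of H),
    smul_eq_mul, normSq]

theorem gramDet_eq_sq {ρ : ℝ} {H : Fin nR → Fin nT → ℝ} {B : Matrix (Fin nT) (Fin nT) ℝ}
    (hB : Bᵀ * B = 1 + ρ ^ 2 • ((of H)ᵀ * of H)) : gramDet ρ H = B.det ^ 2 := by
  rw [gramDet_eq, ← hB, det_mul, det_transpose, sq]

theorem gramDet_eq_prod (ρ : ℝ) (H : Fin nR → Fin nT → ℝ) :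
    gramDet ρ H = ∏ i, (1 + ρ ^ 2 * eig H i) := by
  have hA := isHermitian_mul_conjTranspose_self (of H)
  have h := hA.spectral_theorem
  set U := hA.eigenvectorUnitary
  have e : (1 : Matrix (Fin nR) (Fin nR) ℝ) + ρ ^ 2 • (of H * (of H)ᵀ)
      = (U : Matrix (Fin nR) (Fin nR) ℝ) * diagonal (fun i => 1 + ρ ^ 2 * eig H i)
        * (star U : Matrix (Fin nR) (Fin nR) ℝ) := by
    have h2 : diagonal (fun i => 1 + ρ ^ 2 * eig H i)
        = 1 + ρ ^ 2 • diagonal (eig H) := by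
      ext i j
      by_cases hij : i = j <;> simp [hij, diagonal]
    rw [h2, mul_add, add_mul, mul_one, Matrix.mul_smul, Matrix.smul_mul]
    congr 1
    · exact (Unitary.mul_star_self_of_mem U.2).symm
    · congr 1
  rw [gramDet, e, det_mul, det_mul, det_diagonal, mul_right_comm, ← det_mul,
    show (U : Matrix (Fin nR) (Fin nR) ℝ) * (star U : Matrix (Fin nR) (Fin nR) ℝ) = 1 from
      Unitary.mul_star_self_of_mem U.2, det_one, one_mul]

theorem eig_nonneg (H : Fin nR → Fin nT → ℝ) (i : Fin nR) : 0 ≤ eig H i :=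
  eigenvalues_self_mul_conjTranspose_nonneg _ _

theorem eig_pos {H : Fin nR → Fin nT → ℝ} (hH : LinearIndependent ℝ H) (i : Fin nR) :
    0 < eig H i := by
  refine PosDef.eigenvalues_pos (A := of H * (of H)ᴴ) ?_ i
  exact PosDef.mul_conjTranspose_self _ (Matrix.vecMul_injective_iff.2 hH)

theorem one_le_gramDet (ρ : ℝ) (H : Fin nR → Fin nT → ℝ) : 1 ≤ gramDet ρ H := by
  rw [gramDet_eq_prod]
  refine Finset.prod_induction _ (fun x => 1 ≤ x) (fun a b ha hb => one_le_mul_of_one_le_of_one_le ha hb) le_rfl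
    fun i _ => ?_
  have := mul_nonneg (sq_nonneg ρ) (eig_nonneg H i)
  linarith

@[fun_prop]
theorem continuous_gramDet (ρ : ℝ) : Continuous (gramDet ρ : (Fin nR → Fin nT → ℝ) → ℝ) := by
  unfold gramDet
  have h : Continuous fun H : Fin nR → Fin nT → ℝ => of H * (of H)ᵀ :=
    Continuous.matrix_mul continuous_id (Continuous.matrix_transpose continuous_id)
  exact Continuous.matrix_det (continuous_const.add (h.const_smul (ρ ^ 2)))

/-! ### Gaussian integrals of quadratic forms in the input -/

section GaussianIntegral

theorem lintegral_exp_neg_normSq {n : ℕ} {κ : ℝ} (hκ : 0 < κ) :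
    ∫⁻ x : Fin n → ℝ, ENNReal.ofReal (Real.exp (-normSq x / κ))
      = ENNReal.ofReal (√(Real.pi * κ) ^ n) := by
  have h1 : ∀ x : Fin n → ℝ, ENNReal.ofReal (Real.exp (-normSq x / κ))
      = ∏ i, ENNReal.ofReal (Real.exp (-κ⁻¹ * x i ^ 2)) := by
    intro x
    rw [← ENNReal.ofReal_prod_of_nonneg fun i _ => (Real.exp_pos _).le, ← Real.exp_sum,
      normSq_eq_sum, ← Finset.mul_sum]
    congr 2
    field_simp
  simp_rw [h1]
  rw [volume_pi, lintegral_pi_prod (f := fun _ t => ENNReal.ofReal (Real.exp (-κ⁻¹ * t ^ 2)))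
    fun i => by fun_prop]
  rw [← ofReal_integral_eq_lintegral_ofReal (integrable_exp_neg_mul_sq (inv_pos.2 hκ))
    (ae_of_all _ fun x => (Real.exp_pos _).le), integral_gaussian]
  simp [ENNReal.ofReal_pow]

theorem lintegral_exp_neg_normSq_mulVec {n : ℕ} {κ : ℝ} (hκ : 0 < κ)
    {B : Matrix (Fin n) (Fin n) ℝ} (hB : B.det ≠ 0) :
    ∫⁻ x : Fin n → ℝ, ENNReal.ofReal (Real.exp (-normSq (B *ᵥ x) / κ))
      = ENNReal.ofReal (√(Real.pi * κ) ^ n / |B.det|) := by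
  have h := Real.map_matrix_volume_pi_eq_smul_volume_pi hB
  have hm : Measurable (toLin' B) := by
    exact (LinearMap.continuous_of_finiteDimensional _).measurable
  have h2 : ∫⁻ x : Fin n → ℝ, ENNReal.ofReal (Real.exp (-normSq (B *ᵥ x) / κ))
      = ∫⁻ x, ENNReal.ofReal (Real.exp (-normSq x / κ)) ∂(Measure.map (toLin' B) volume) := by
    rw [lintegral_map (by fun_prop) hm]
    simp
  rw [h2, h, lintegral_smul_measure, lintegral_exp_neg_normSq hκ, smul_eq_mul,
    ← ENNReal.ofReal_mul (abs_nonneg _), abs_inv, div_eq_inv_mul]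

theorem lintegral_exp_neg_form {ρ κ : ℝ} (hρ : 0 < ρ) (hκ : 0 < κ) (H : Fin nR → Fin nT → ℝ) :
    ∫⁻ u, ENNReal.ofReal (Real.exp (-(normSq (of H *ᵥ u) + normSq u / ρ ^ 2) / κ))
      = ENNReal.ofReal ((√(Real.pi * κ) * ρ) ^ nT / √(gramDet ρ H)) := by
  obtain ⟨B, hB⟩ := exists_factor ρ H
  have hd := gramDet_eq_sq hB
  have hB0 : B.det ≠ 0 := by
    intro h
    have := one_le_gramDet ρ H
    rw [hd, h] at this
    norm_num at this
  have h1 : ∀ u, -(normSq (of H *ᵥ u) + normSq u / ρ ^ 2) / κ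
      = -normSq (B *ᵥ u) / (κ * ρ ^ 2) := by
    intro u
    rw [normSq_mulVec_factor hB]
    field_simp
    ring
  simp_rw [h1]
  rw [lintegral_exp_neg_normSq_mulVec (by positivity) hB0, hd, Real.sqrt_sq_eq_abs, ← mul_assoc,
    Real.sqrt_mul (by positivity), Real.sqrt_sq hρ.le]

/-- Complete the square: translating to the minimiser x₀ of the exponent leaves the centred form
plus a nonnegative constant, so the bound is uniform in y. -/
theorem lintegral_exp_neg_form_sub_le {ρ κ : ℝ} (hρ : 0 < ρ) (hκ : 0 < κ)
    (H : Fin nR → Fin nT → ℝ) (y : Fin nR → ℝ) :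
    ∫⁻ x, ENNReal.ofReal (Real.exp (-(normSq (y - of H *ᵥ x) + normSq x / ρ ^ 2) / κ))
      ≤ ENNReal.ofReal ((√(Real.pi * κ) * ρ) ^ nT / √(gramDet ρ H)) := by
  have hdet : IsUnit (1 + ρ ^ 2 • ((of H)ᵀ * of H)).det := by
    rw [← gramDet_eq, isUnit_iff_ne_zero]
    linarith [one_le_gramDet ρ H]
  set M := 1 + ρ ^ 2 • ((of H)ᵀ * of H) with hM
  obtain ⟨x₀, hx₀⟩ : ∃ x₀, M *ᵥ x₀ = ρ ^ 2 • ((of H)ᵀ *ᵥ y) :=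
    ⟨M⁻¹ *ᵥ (ρ ^ 2 • ((of H)ᵀ *ᵥ y)), by rw [mulVec_mulVec, mul_nonsing_inv _ hdet, one_mulVec]⟩
  rw [← lintegral_exp_neg_form hρ hκ H, ← lintegral_add_right_eq_self _ x₀]
  refine lintegral_mono fun u => ENNReal.ofReal_le_ofReal (Real.exp_le_exp.2 ?_)
  -- The normal equation for x₀: it makes the two terms linear in u cancel.
  have hcross : (y - of H *ᵥ x₀) ⬝ᵥ (of H *ᵥ u) = (x₀ ⬝ᵥ u) / ρ ^ 2 := by
    have h1 : (x₀ + ρ ^ 2 • ((of H)ᵀ *ᵥ (of H *ᵥ x₀))) ⬝ᵥ u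
        = (ρ ^ 2 • ((of H)ᵀ *ᵥ y)) ⬝ᵥ u := by
      rw [← hx₀, hM, add_mulVec, one_mulVec, smul_mulVec, mulVec_mulVec]
    have h2 : ∀ w : Fin nR → ℝ, ((of H)ᵀ *ᵥ w) ⬝ᵥ u = w ⬝ᵥ (of H *ᵥ u) := by
      intro w
      rw [mulVec_transpose, dotProduct_mulVec]
    rw [add_dotProduct, smul_dotProduct, smul_dotProduct, h2, h2, smul_eq_mul, smul_eq_mul] at h1
    rw [sub_dotProduct, eq_div_iff (by positivity)]
    linarith
  have e : normSq (y - of H *ᵥ (u + x₀)) + normSq (u + x₀) / ρ ^ 2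
      = (normSq (of H *ᵥ u) + normSq u / ρ ^ 2)
        + (normSq (y - of H *ᵥ x₀) + normSq x₀ / ρ ^ 2) := by
    have : y - of H *ᵥ (u + x₀) = (y - of H *ᵥ x₀) - of H *ᵥ u := by
      rw [mulVec_add]; abel
    rw [this, normSq_sub, hcross, normSq_add, dotProduct_comm u x₀]
    ring
  rw [e, div_le_div_iff_of_pos_right hκ, neg_le_neg_iff]
  have := normSq_nonneg (y - of H *ᵥ x₀)
  have := div_nonneg (normSq_nonneg x₀) (sq_nonneg ρ)
  linarith

end GaussianIntegral

end OWC

namespace OWC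

/-! ### Bounds for the Kullback–Leibler divergence -/

section Divergence

open InformationTheory

variable {α β : Type*} [MeasurableSpace α] [MeasurableSpace β]

/-- The lower bound of Donsker and Varadhan for the Kullback-Leibler divergence. -/
theorem ofReal_integral_sub_log_le_klDiv {P Q : Measure α} [IsProbabilityMeasure P]
    [IsProbabilityMeasure Q] {g : α → ℝ} (hg : Integrable g P)
    (hQ : Integrable (fun x => Real.exp (g x)) Q) :
    ENNReal.ofReal (∫ x, g x ∂P - Real.log (∫ x, Real.exp (g x) ∂Q)) ≤ klDiv P Q := by
  by_cases htop : klDiv P Q = ∞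
  · rw [htop]; exact le_top
  obtain ⟨hac, hint⟩ := klDiv_ne_top_iff.1 htop
  rw [klDiv_of_ac_of_integrable hac hint]
  refine ENNReal.ofReal_le_ofReal ?_
  -- Tilting Q by exp g changes the divergence by exactly ∫ g dP - log ∫ exp g dQ; what remains is a
  -- divergence, hence nonnegative.
  have := isProbabilityMeasure_tilted hQ
  have h1 := integral_llr_tilted_right hac hg hQ hint
  have h2 := integral_llr_add_sub_measure_univ_nonneg
    (hac.trans (absolutelyContinuous_tilted hQ)) (integrable_llr_tilted_right hac hg hint hQ)
  simp only [probReal_univ] at h2 ⊢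
  linarith

/-- The density of P is at most B almost everywhere, so its logarithm averages to at most log B.
Working with `klFun` in lower integrals requires no integrability of the log-density. -/
theorem klDiv_le_of_le_smul {P Q : Measure α} [IsProbabilityMeasure P] [IsProbabilityMeasure Q]
    {B : ℝ} (h : P ≤ ENNReal.ofReal B • Q) : klDiv P Q ≤ ENNReal.ofReal (Real.log B) := by
  have hB : 1 ≤ B := by
    have := h Set.univ
    simpa using this
  have hac : P ≪ Q := (Measure.absolutelyContinuous_of_le_smul h)
  have hrn : ∀ᵐ x ∂Q, P.rnDeriv Q x ≤ ENNReal.ofReal B := by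
    refine ae_le_of_forall_setLIntegral_le_of_sigmaFinite (Measure.measurable_rnDeriv _ _)
      fun s hs _ => ?_
    rw [Measure.setLIntegral_rnDeriv hac, setLIntegral_const]
    exact h s
  rw [klDiv_eq_lintegral_klFun_of_ac hac]
  have h1 : ∫⁻ x, P.rnDeriv Q x ∂Q = 1 := by
    rw [Measure.lintegral_rnDeriv hac, measure_univ]
  -- Since `klFun t` is t log t + 1 - t, adding the density (of integral 1) removes the subtraction:
  -- t log t + 1 ≤ t log B + 1.
  have h2 : ∫⁻ x, ENNReal.ofReal (klFun (P.rnDeriv Q x).toReal) ∂Q + 1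
      ≤ ENNReal.ofReal (Real.log B) + 1 := by
    calc _ = ∫⁻ x, (ENNReal.ofReal (klFun (P.rnDeriv Q x).toReal) + P.rnDeriv Q x) ∂Q := by
          rw [lintegral_add_right _ (Measure.measurable_rnDeriv _ _), h1]
      _ ≤ ∫⁻ x, (ENNReal.ofReal (Real.log B) * P.rnDeriv Q x + 1) ∂Q := by
          refine lintegral_mono_ae ?_
          filter_upwards [hrn] with x hx
          have hx' : P.rnDeriv Q x ≠ ∞ := (hx.trans_lt ENNReal.ofReal_lt_top).ne
          lift P.rnDeriv Q x to ℝ≥0 using hx' with t ht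
          have ht' : (t : ℝ) ≤ B := by
            rw [← ENNReal.ofReal_coe_nnreal] at hx
            exact (ENNReal.ofReal_le_ofReal_iff (by linarith)).1 hx
          rw [ENNReal.coe_toReal, ← ENNReal.ofReal_coe_nnreal,
            ← ENNReal.ofReal_mul (Real.log_nonneg hB), ← ENNReal.ofReal_one,
            ← ENNReal.ofReal_add (klFun_nonneg t.coe_nonneg) t.coe_nonneg,
            ← ENNReal.ofReal_add (mul_nonneg (Real.log_nonneg hB) t.coe_nonneg) zero_le_one]
          refine ENNReal.ofReal_le_ofReal ?_
          rw [klFun_apply]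
          rcases eq_or_lt_of_le (NNReal.coe_nonneg t) with h0 | h0
          · rw [← h0]; simp
          · have := Real.log_le_log h0 ht'
            nlinarith
      _ = ENNReal.ofReal (Real.log B) + 1 := by
          rw [lintegral_add_right _ measurable_const,
            lintegral_const_mul _ (Measure.measurable_rnDeriv _ _), h1]
          simp
  exact (ENNReal.add_le_add_iff_right ENNReal.one_ne_top).1 h2

/-- Replacing the second marginal by any other law can only increase the divergence from the
product law. -/
theorem klDiv_prod_marginals_le [StandardBorelSpace α] [Nonempty α] (P : Measure (α × β))
    [IsProbabilityMeasure P] (N : Measure β) [IsProbabilityMeasure N] :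
    klDiv P (P.fst.prod P.snd) ≤ klDiv P (P.fst.prod N) := by
  set S := P.map Prod.swap with hS
  have : IsProbabilityMeasure S := Measure.isProbabilityMeasure_map measurable_swap.aemeasurable
  have hSP : S.map Prod.swap = P := by
    rw [hS, Measure.map_map measurable_swap measurable_swap]; simp
  have hfst : S.fst = P.snd := by
    rw [hS, Measure.fst_map_swap]
  have hdis : S.fst ⊗ₘ S.condKernel = S := S.disintegrate _
  have hswap : ∀ M : Measure β, [IsProbabilityMeasure M] →
      M ⊗ₘ (Kernel.const β P.fst) = (P.fst.prod M).map Prod.swap := by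
    intro M _
    rw [Measure.compProd_const, Measure.prod_swap]
  have h1 : klDiv P (P.fst.prod P.snd) ≤ klDiv S (S.fst ⊗ₘ (Kernel.const β P.fst)) := by
    have := klDiv_map_le (μ := S) (ν := S.fst ⊗ₘ (Kernel.const β P.fst)) measurable_swap
    rw [hSP, Measure.compProd_const, Measure.prod_swap, hfst] at this
    rwa [Measure.compProd_const, hfst]
  -- Chain rule along the output, hence the swap: changing the output law to N adds the divergence
  -- of the true output law from N.
  have h2 := klDiv_compProd_eq_add S.fst N S.condKernel (Kernel.const β P.fst)
  rw [hdis] at h2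
  have h3 : klDiv S (N ⊗ₘ (Kernel.const β P.fst)) ≤ klDiv P (P.fst.prod N) := by
    rw [hswap N]
    exact klDiv_map_le _ _ measurable_swap
  calc _ ≤ _ := h1
    _ ≤ klDiv S (N ⊗ₘ (Kernel.const β P.fst)) := by rw [h2]; exact le_add_self
    _ ≤ _ := h3

end Divergence

end OWC

namespace OWC

open Matrix

/-! ### Truncated exponential inputs averaged against a Gaussian bump -/

section TruncatedExponential

theorem truncExp_factor_pos (m : ℝ) : 0 < (if m = 0 then 1 else m / (1 - Real.exp (-m))) := by
  split_ifs with h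
  · exact one_pos
  · rcases lt_or_gt_of_ne h with h | h
    · have : 1 < Real.exp (-m) := Real.one_lt_exp_iff.2 (by linarith)
      exact div_pos_of_neg_of_neg h (by linarith)
    · have : Real.exp (-m) < 1 := Real.exp_lt_one_iff.2 (by linarith)
      exact div_pos h (by linarith)

theorem isProbabilityMeasure_truncExp {A : ℝ} (hA : 0 < A) (m : ℝ) :
    IsProbabilityMeasure (truncExp A m) := by
  refine ⟨?_⟩
  rw [truncExp, withDensity_apply _ .univ, Measure.restrict_univ]
  have hc : Continuous (truncExpPDF A m) := by unfold truncExpPDF; fun_prop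
  rw [← ofReal_integral_eq_lintegral_ofReal (hc.integrableOn_Icc) (ae_of_all _ fun x => ?_)]
  · rw [integral_Icc_eq_integral_Ioc, ← intervalIntegral.integral_of_le hA.le]
    simp_rw [truncExpPDF]
    rw [intervalIntegral.integral_const_mul]
    split_ifs with h
    · simp [h, hA.ne']
    · have h1 : (∫ x in (0 : ℝ)..A, Real.exp (-(m * x / A))) = A / m * (1 - Real.exp (-m)) := by
        have e : ∀ x, -(m * x / A) = (-(m / A)) * x := fun x => by ring
        simp_rw [e]
        rw [intervalIntegral.integral_comp_mul_left (fun x => Real.exp x)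
          (neg_ne_zero.2 (div_ne_zero h hA.ne')), integral_exp, mul_zero, Real.exp_zero,
          smul_eq_mul]
        have : -(m / A) * A = -m := by field_simp
        rw [this]
        field_simp
        ring
      rw [h1]
      have : 1 - Real.exp (-m) ≠ 0 := by
        rw [sub_ne_zero]
        intro h2
        exact h (by simpa using (Real.exp_eq_one_iff _).1 h2.symm)
      field_simp
      simp
  · unfold truncExpPDF
    have := truncExp_factor_pos m
    positivity

/-- The density is of order 1/ρ on an interval of length ρa, where the Gaussian kernel at scale ρ is
at least exp(-a²/κ). Replacing the interval by that kernel makes later integrals explicit. -/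
theorem truncExp_le {a κ : ℝ} (ha : 0 < a) (hκ : 0 < κ) (m : ℝ) : ∃ C : ℝ, 0 < C ∧ ∀ ρ : ℝ, 0 < ρ →
    truncExp (ρ * a) m ≤ ((C / ρ).toNNReal : ℝ≥0∞) •
      volume.withDensity fun x => ENNReal.ofReal (Real.exp (-(x ^ 2 / ρ ^ 2) / κ)) := by
  set k : ℝ := if m = 0 then 1 else m / (1 - Real.exp (-m)) with hk
  have hk0 : 0 < k := truncExp_factor_pos m
  refine ⟨1 / a * k * Real.exp |m| * Real.exp (a ^ 2 / κ), by positivity, fun ρ hρ => ?_⟩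
  rw [truncExp, ← withDensity_indicator measurableSet_Icc, ← withDensity_smul _ (by fun_prop)]
  refine withDensity_mono (ae_of_all _ fun x => ?_)
  by_cases hx : x ∈ Set.Icc 0 (ρ * a)
  · rw [Set.indicator_of_mem hx, Pi.smul_apply, smul_eq_mul]
    change _ ≤ ENNReal.ofReal _ * _
    rw [← ENNReal.ofReal_mul (by positivity)]
    refine ENNReal.ofReal_le_ofReal ?_
    rw [truncExpPDF, ← hk]
    have h1 : x / (ρ * a) ≤ 1 := (div_le_one (by positivity)).2 hx.2
    have h2 : Real.exp (-(m * x / (ρ * a))) ≤ Real.exp |m| := by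
      refine Real.exp_le_exp.2 ?_
      have h3 : -(m * x / (ρ * a)) = (-m) * (x / (ρ * a)) := by ring
      have h4 : 0 ≤ x / (ρ * a) := div_nonneg hx.1 (by positivity)
      rw [h3]
      calc -m * (x / (ρ * a)) ≤ |m| * (x / (ρ * a)) :=
            mul_le_mul_of_nonneg_right (neg_le_abs m) h4
        _ ≤ |m| * 1 := mul_le_mul_of_nonneg_left h1 (abs_nonneg m)
        _ = |m| := mul_one _
    have h5 : 1 ≤ Real.exp (a ^ 2 / κ) * Real.exp (-(x ^ 2 / ρ ^ 2) / κ) := by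
      rw [← Real.exp_add, Real.one_le_exp_iff, ← add_div]
      refine div_nonneg ?_ hκ.le
      have : x ^ 2 / ρ ^ 2 ≤ a ^ 2 := by
        rw [div_le_iff₀ (by positivity), ← mul_pow, mul_comm a]
        exact pow_le_pow_left₀ hx.1 hx.2 2
      linarith
    calc 1 / (ρ * a) * k * Real.exp (-(m * x / (ρ * a)))
        ≤ 1 / (ρ * a) * k * Real.exp |m| := by gcongr
      _ ≤ 1 / (ρ * a) * k * Real.exp |m|
          * (Real.exp (a ^ 2 / κ) * Real.exp (-(x ^ 2 / ρ ^ 2) / κ)) :=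
          le_mul_of_one_le_right (by positivity) h5
      _ = _ := by field_simp
  · rw [Set.indicator_of_notMem hx]; exact zero_le

variable {nR nT : ℕ}

theorem Channel.peak_pos (c : Channel nR nT) {ρ : ℝ} (hρ : 0 < ρ) : 0 < c.peak ρ := by
  have := c.σ_pos
  have := c.α_pos
  unfold Channel.peak Channel.avgPower
  positivity

theorem isProbabilityMeasure_teInput (c : Channel nR nT) (m : ℝ) {ρ : ℝ} (hρ : 0 < ρ) :
    IsProbabilityMeasure (c.teInput m ρ) := by
  have := isProbabilityMeasure_truncExp (c.peak_pos hρ) m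
  unfold Channel.teInput
  infer_instance

/-- The key estimate, used with κ = 2σ² for mutual information and κ = 8σ² for decoding errors. The
ρ^(-nT) from the input density cancels the ρ^nT of the Gaussian integral, leaving 1/√D. -/
theorem lintegral_teInput_exp_le (c : Channel nR nT) (m : ℝ) {κ : ℝ} (hκ : 0 < κ) :
    ∃ C : ℝ, 0 < C ∧ ∀ ρ : ℝ, 0 < ρ → ∀ (H : Fin nR → Fin nT → ℝ) (y : Fin nR → ℝ),
      ∫⁻ x, ENNReal.ofReal (Real.exp (-normSq (y - of H *ᵥ x) / κ)) ∂(c.teInput m ρ)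
        ≤ ENNReal.ofReal (C / √(gramDet ρ H)) := by
  have ha : 0 < (c.σ : ℝ) / c.α := div_pos (by exact_mod_cast c.σ_pos) c.α_pos
  obtain ⟨C, hC, h⟩ := truncExp_le ha hκ m
  refine ⟨(C * √(Real.pi * κ)) ^ nT, by positivity, fun ρ hρ H y => ?_⟩
  have hpk : c.peak ρ = ρ * (c.σ / c.α) := by unfold Channel.peak Channel.avgPower; ring
  have := isProbabilityMeasure_truncExp (c.peak_pos hρ) m
  have hle : c.teInput m ρ ≤ ((∏ _i : Fin nT, (C / ρ).toNNReal : ℝ≥0) : ℝ≥0∞) •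
      Measure.pi fun _ => volume.withDensity fun x : ℝ =>
        ENNReal.ofReal (Real.exp (-(x ^ 2 / ρ ^ 2) / κ)) := by
    refine pi_le_smul_pi (fun _ => ?_) fun _ => ?_
    · exact (Real.toNNReal_pos.2 (by positivity)).ne'
    · rw [hpk]; exact h ρ hρ
  have hprod : ((∏ _i : Fin nT, (C / ρ).toNNReal : ℝ≥0) : ℝ≥0∞) = ENNReal.ofReal ((C / ρ) ^ nT) := by
    rw [Finset.prod_const, Finset.card_univ, Fintype.card_fin, ← Real.toNNReal_pow (by positivity)]
    rfl
  rw [hprod, pi_withDensity fun i => by fun_prop, ← volume_pi] at hle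
  refine (lintegral_mono' hle le_rfl).trans ?_
  rw [lintegral_smul_measure, lintegral_withDensity_eq_lintegral_mul _ (by fun_prop) (by fun_prop)]
  have e : ∀ x : Fin nT → ℝ, ((fun x : Fin nT → ℝ => ∏ i, ENNReal.ofReal
      (Real.exp (-(x i ^ 2 / ρ ^ 2) / κ))) * fun x => ENNReal.ofReal
      (Real.exp (-normSq (y - of H *ᵥ x) / κ))) x = ENNReal.ofReal
        (Real.exp (-(normSq (y - of H *ᵥ x) + normSq x / ρ ^ 2) / κ)) := by
    intro x
    rw [Pi.mul_apply, ← ENNReal.ofReal_prod_of_nonneg fun i _ => (Real.exp_pos _).le,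
      ← Real.exp_sum, ← ENNReal.ofReal_mul (Real.exp_pos _).le, ← Real.exp_add,
      ← Finset.sum_div, Finset.sum_neg_distrib, ← Finset.sum_div, ← normSq_eq_sum]
    congr 2
    ring
  simp_rw [e, smul_eq_mul]
  refine (mul_le_mul_right (lintegral_exp_neg_form_sub_le hρ hκ H y) _).trans_eq ?_
  rw [← ENNReal.ofReal_mul (by positivity)]
  congr 1
  rw [mul_pow, mul_pow, div_pow]
  field_simp

end TruncatedExponential

end OWC

namespace OWC

open Matrix

/-! ### Mutual information is (1/2) log D up to constants -/

section MutualInformation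

variable {nR nT : ℕ}

theorem pi_gaussianReal_eq {n : ℕ} {v : ℝ≥0} (hv : v ≠ 0) :
    Measure.pi (fun _ : Fin n => gaussianReal 0 v) = volume.withDensity fun z =>
      ENNReal.ofReal ((√(2 * Real.pi * v))⁻¹ ^ n * Real.exp (-normSq z / (2 * v))) := by
  have h1 : gaussianReal 0 v = volume.withDensity (gaussianPDF 0 v) :=
    gaussianReal_of_var_ne_zero 0 hv
  have : SigmaFinite ((volume : Measure ℝ).withDensity (gaussianPDF 0 v)) := by
    rw [← h1]; infer_instance
  rw [h1, pi_withDensity fun _ => measurable_gaussianPDF 0 v, ← volume_pi]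
  congr 1
  ext z
  simp only [gaussianPDF, gaussianPDFReal]
  rw [← ENNReal.ofReal_prod_of_nonneg fun i _ => by positivity, Finset.prod_mul_distrib,
    ← Real.exp_sum, Finset.prod_const, Finset.card_univ, Fintype.card_fin, normSq_eq_sum,
    ← Finset.sum_div, Finset.sum_neg_distrib]
  simp

instance (c : Channel nR nT) : IsProbabilityMeasure c.noiseVec := by
  unfold Channel.noiseVec; infer_instance

theorem Channel.σ_sq_ne_zero (c : Channel nR nT) : c.σ ^ 2 ≠ 0 := pow_ne_zero _ c.σ_pos.ne'

theorem Channel.σ_real_pos (c : Channel nR nT) : 0 < (c.σ : ℝ) := by exact_mod_cast c.σ_pos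

theorem measurable_addNoise (H : Fin nR → Fin nT → ℝ) :
    Measurable fun xz : (Fin nT → ℝ) × (Fin nR → ℝ) => (of H).mulVec xz.1 + xz.2 := by
  have : Continuous fun xz : (Fin nT → ℝ) × (Fin nR → ℝ) => (of H).mulVec xz.1 + xz.2 := by
    fun_prop
  exact this.measurable

theorem measurable_inputOutput (H : Fin nR → Fin nT → ℝ) :
    Measurable fun xz : (Fin nT → ℝ) × (Fin nR → ℝ) => (xz.1, (of H).mulVec xz.1 + xz.2) :=
  measurable_fst.prodMk (measurable_addNoise H)

theorem isProbabilityMeasure_jointXY (c : Channel nR nT) (p : Measure (Fin nT → ℝ))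
    [IsProbabilityMeasure p] (H : Fin nR → Fin nT → ℝ) : IsProbabilityMeasure (c.jointXY p H) :=
  Measure.isProbabilityMeasure_map (measurable_inputOutput H).aemeasurable

theorem fst_jointXY (c : Channel nR nT) (p : Measure (Fin nT → ℝ)) [IsProbabilityMeasure p]
    (H : Fin nR → Fin nT → ℝ) : (c.jointXY p H).fst = p := by
  rw [Channel.jointXY, Measure.fst, Measure.map_map measurable_fst (measurable_inputOutput H)]
  change Measure.map Prod.fst (p.prod c.noiseVec) = p
  simp

theorem integrable_normSq_noiseVec (c : Channel nR nT) : Integrable normSq c.noiseVec := by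
  rw [show (normSq : (Fin nR → ℝ) → ℝ) = fun v => ∑ i, v i ^ 2 from funext normSq_eq_sum]
  refine integrable_finsetSum _ fun i _ => ?_
  have h : Integrable (fun x : ℝ => x ^ 2) (gaussianReal 0 (c.σ ^ 2)) :=
    (memLp_id_gaussianReal 2).integrable_sq
  exact (measurePreserving_eval (fun _ : Fin nR => gaussianReal 0 (c.σ ^ 2)) i).integrable_comp_of_integrable h

/-- Truncated exponential inputs reach, up to a constant, the mutual information
`log det (1 + ρ² H Hᵀ) / 2`. -/
theorem le_mutualInfo_teInput (c : Channel nR nT) (m : ℝ) :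
    ∃ K : ℝ, ∀ ρ : ℝ, 0 < ρ → ∀ H : Fin nR → Fin nT → ℝ,
      ENNReal.ofReal (Real.log (gramDet ρ H) / 2 - K) ≤ c.mutualInfo (c.teInput m ρ) H := by
  have hσ := c.σ_real_pos
  set κ : ℝ := 2 * (c.σ : ℝ) ^ 2 with hκ
  have hκ0 : 0 < κ := by positivity
  obtain ⟨C, hC, hbound⟩ := lintegral_teInput_exp_le c m hκ0
  refine ⟨(∫ z, normSq z / κ ∂c.noiseVec) + Real.log C, fun ρ hρ H => ?_⟩
  have := isProbabilityMeasure_teInput c m hρ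
  set p := c.teInput m ρ
  have := isProbabilityMeasure_jointXY c p H
  set P := c.jointXY p H with hP
  -- Under the joint law y - Hx is the noise, so the mean of g does not depend on H or ρ; under the
  -- product law, averaging exp g over x for fixed y gives at most C/√D.
  set g : (Fin nT → ℝ) × (Fin nR → ℝ) → ℝ := fun xy => -normSq (xy.2 - of H *ᵥ xy.1) / κ with hg
  have hgc : Continuous g := by rw [hg]; fun_prop
  have hcomp : (g ∘ fun xz : (Fin nT → ℝ) × (Fin nR → ℝ) => (xz.1, (of H).mulVec xz.1 + xz.2))
      = fun xz => -(normSq xz.2 / κ) := by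
    ext xz
    simp [hg, neg_div]
  have hint0 : Integrable (fun z => normSq z / κ) c.noiseVec :=
    (integrable_normSq_noiseVec c).div_const κ
  have hgP : Integrable g P := by
    rw [hP, Channel.jointXY, integrable_map_measure hgc.aestronglyMeasurable
      (measurable_inputOutput H).aemeasurable, hcomp]
    exact (hint0.comp_snd p).neg
  have hgI : ∫ x, g x ∂P = -∫ z, normSq z / κ ∂c.noiseVec := by
    rw [hP, Channel.jointXY, integral_map (measurable_inputOutput H).aemeasurable
      hgc.aestronglyMeasurable]
    change ∫ x, (g ∘ fun xz : (Fin nT → ℝ) × (Fin nR → ℝ) =>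
      (xz.1, (of H).mulVec xz.1 + xz.2)) x ∂_ = _
    rw [hcomp, integral_neg, integral_fun_snd (fun z => normSq z / κ)]
    simp
  set Q := P.fst.prod P.snd with hQ
  have hle1 : ∀ x, Real.exp (g x) ≤ 1 := fun x => by
    rw [Real.exp_le_one_iff, hg]
    exact div_nonpos_of_nonpos_of_nonneg (neg_nonpos.2 (normSq_nonneg _)) hκ0.le
  have hexp : Integrable (fun x => Real.exp (g x)) Q := by
    refine Integrable.of_bound (by fun_prop) 1 (ae_of_all _ fun x => ?_)
    rw [Real.norm_of_nonneg (Real.exp_pos _).le]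
    exact hle1 x
  have hD : 0 < gramDet ρ H := one_pos.trans_le (one_le_gramDet ρ H)
  have hup : ∫ x, Real.exp (g x) ∂Q ≤ C / √(gramDet ρ H) := by
    rw [integral_eq_lintegral_of_nonneg_ae (ae_of_all _ fun x => (Real.exp_pos _).le) (by fun_prop)]
    refine ENNReal.toReal_le_of_le_ofReal (by positivity) ?_
    rw [hQ, lintegral_prod_symm _ (by fun_prop), hP, fst_jointXY c p H]
    refine (lintegral_mono fun y => hbound ρ hρ H y).trans_eq ?_
    simp
  refine le_trans (ENNReal.ofReal_le_ofReal ?_) (ofReal_integral_sub_log_le_klDiv hgP hexp)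
  have hlog : Real.log (∫ x, Real.exp (g x) ∂Q) ≤ Real.log C - Real.log (gramDet ρ H) / 2 := by
    rw [← Real.log_sqrt hD.le, ← Real.log_div hC.ne' (by positivity)]
    exact Real.log_le_log (integral_exp_pos hexp) hup
  rw [hgI]
  linarith

theorem noiseVec_eq (c : Channel nR nT) : c.noiseVec = volume.withDensity fun z =>
    ENNReal.ofReal ((√(2 * Real.pi * (c.σ : ℝ) ^ 2))⁻¹ ^ nR
      * Real.exp (-normSq z / (2 * (c.σ : ℝ) ^ 2))) := by
  have := pi_gaussianReal_eq (n := nR) c.σ_sq_ne_zero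
  push_cast at this
  exact this

theorem noiseVec_shift_apply (c : Channel nR nT) (w : Fin nR → ℝ) {T : Set (Fin nR → ℝ)}
    (hT : MeasurableSet T) :
    c.noiseVec ((fun z => w + z) ⁻¹' T) = ∫⁻ y in T,
      ENNReal.ofReal ((√(2 * Real.pi * (c.σ : ℝ) ^ 2))⁻¹ ^ nR
        * Real.exp (-normSq (y - w) / (2 * (c.σ : ℝ) ^ 2))) := by
  have hpre : MeasurableSet ((fun z => w + z) ⁻¹' T) := (measurable_const_add w) hT
  rw [noiseVec_eq, withDensity_apply _ hpre, ← lintegral_indicator hpre, ← lintegral_indicator hT,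
    ← lintegral_sub_right_eq_self _ w]
  congr 1
  ext y
  by_cases hy : y ∈ T <;> simp [Set.indicator, hy]

/-- Symmetrization removes the linear term from a Gaussian-type integral. -/
theorem lintegral_le_lintegral_exp_mul {n : ℕ} {F : (Fin n → ℝ) → ℝ} (hF : Continuous F)
    (hF0 : ∀ u, 0 ≤ F u) (hFs : ∀ u, F (-u) = F u) {t : (Fin n → ℝ) → ℝ} (ht : Continuous t)
    (hts : ∀ u, t (-u) = -t u) :
    ∫⁻ u, ENNReal.ofReal (F u) ≤ ∫⁻ u, ENNReal.ofReal (Real.exp (t u) * F u) := by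
  have h1 : ∫⁻ u, ENNReal.ofReal (Real.exp (t u) * F u)
      = ∫⁻ u, ENNReal.ofReal (Real.exp (-t u) * F u) := by
    rw [← lintegral_neg_eq_self]
    simp_rw [hFs, hts]
  -- Average the integral with its reflection and use exp t + exp(-t) ≥ 2.
  have h2 : 2 * ∫⁻ u, ENNReal.ofReal (F u)
      ≤ 2 * ∫⁻ u, ENNReal.ofReal (Real.exp (t u) * F u) := by
    rw [two_mul (∫⁻ u, ENNReal.ofReal (Real.exp (t u) * F u))]
    nth_rw 2 [h1]
    rw [← lintegral_add_left (by fun_prop), ← lintegral_const_mul _ (by fun_prop)]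
    refine lintegral_mono fun u => ?_
    rw [← ENNReal.ofReal_add (mul_nonneg (Real.exp_pos _).le (hF0 u))
      (mul_nonneg (Real.exp_pos _).le (hF0 u)), ← ENNReal.ofReal_ofNat,
      ← ENNReal.ofReal_mul zero_le_two, ← add_mul]
    refine ENNReal.ofReal_le_ofReal (mul_le_mul_of_nonneg_right ?_ (hF0 u))
    have := Real.add_one_le_exp (t u)
    have := Real.add_one_le_exp (-t u)
    linarith
  exact (ENNReal.mul_le_mul_iff_right two_ne_zero ENNReal.ofNat_ne_top).1 h2

/-- The Gaussian law of the channel output for a fixed bounded input is dominated by the output law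
of a Gaussian input. -/
theorem density_le_mixture {σ ρ b : ℝ} (hσ : 0 < σ) (hρ : 0 < ρ) (k : ℝ) (hk : 0 ≤ k)
    (H : Fin nR → Fin nT → ℝ) {x : Fin nT → ℝ} (hx : normSq x / (2 * σ ^ 2 * ρ ^ 2) ≤ b)
    (y : Fin nR → ℝ) :
    ENNReal.ofReal (k * Real.exp (-normSq (y - of H *ᵥ x) / (2 * σ ^ 2)))
      ≤ ENNReal.ofReal (√(gramDet ρ H) * (Real.exp b * √2 ^ nT)) *
        ∫⁻ x', ENNReal.ofReal ((√(2 * Real.pi * (2 * σ ^ 2 * ρ ^ 2)))⁻¹ ^ nT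
            * Real.exp (-normSq x' / (2 * (2 * σ ^ 2 * ρ ^ 2)))) *
          ENNReal.ofReal (k * Real.exp (-normSq (y - of H *ᵥ x') / (2 * σ ^ 2))) := by
  set z := y - of H *ᵥ x with hz
  set k' := (√(2 * Real.pi * (2 * σ ^ 2 * ρ ^ 2)))⁻¹ ^ nT with hk'
  have hk'0 : 0 < k' := by positivity
  have hD : 0 < gramDet ρ H := one_pos.trans_le (one_le_gramDet ρ H)
  set F : (Fin nT → ℝ) → ℝ := fun u =>
    Real.exp (-(normSq (of H *ᵥ u) + normSq u / ρ ^ 2) / (2 * σ ^ 2)) with hF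
  set t : (Fin nT → ℝ) → ℝ := fun u => (z ⬝ᵥ (of H *ᵥ u)) / σ ^ 2 with ht
  have hneg : ∀ {n : ℕ} (v : Fin n → ℝ), normSq (-v) = normSq v := fun v => by simp [normSq]
  have hFt := lintegral_le_lintegral_exp_mul (F := F) (t := t) (by fun_prop)
    (fun u => (Real.exp_pos _).le) (fun u => by simp only [hF, mulVec_neg, hneg])
    (by rw [ht]; unfold dotProduct; fun_prop) (fun u => by simp only [ht, mulVec_neg, dotProduct_neg, neg_div])
  rw [hF, lintegral_exp_neg_form hρ (by positivity) H] at hFt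
  -- Substitute x' = u + x. The mixing variance is 2σ²ρ² so that ‖u + x‖² ≤ 2‖u‖² + 2‖x‖² leaves
  -- exactly the quadratic form of `lintegral_exp_neg_form`, at the cost of a factor exp(-b). The
  -- linear term t is odd and disappears by symmetrization.
  have hpt : ∀ u, ENNReal.ofReal (k * Real.exp (-normSq z / (2 * σ ^ 2)) * (k' * Real.exp (-b))) *
      ENNReal.ofReal (Real.exp (t u) * F u) ≤ ENNReal.ofReal (k'
            * Real.exp (-normSq (u + x) / (2 * (2 * σ ^ 2 * ρ ^ 2)))) *
          ENNReal.ofReal (k * Real.exp (-normSq (y - of H *ᵥ (u + x)) / (2 * σ ^ 2))) := by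
    intro u
    rw [← ENNReal.ofReal_mul (by positivity), ← ENNReal.ofReal_mul (by positivity)]
    refine ENNReal.ofReal_le_ofReal ?_
    have e1 : y - of H *ᵥ (u + x) = z - of H *ᵥ u := by rw [hz, mulVec_add]; abel
    rw [e1, normSq_sub z]
    have e2 : normSq (u + x) ≤ 2 * normSq u + 2 * normSq x := by
      have h3 := normSq_nonneg (u - x)
      rw [normSq_sub] at h3
      rw [normSq_add]
      linarith
    have e3 : k * Real.exp (-normSq z / (2 * σ ^ 2)) * (k' * Real.exp (-b)) * (Real.exp (t u) * F u)
        = (k' * k) * Real.exp (-normSq z / (2 * σ ^ 2) + -b + (t u +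
          -(normSq (of H *ᵥ u) + normSq u / ρ ^ 2) / (2 * σ ^ 2))) := by
      simp only [Real.exp_add, hF]; ring
    have e4 : k' * Real.exp (-normSq (u + x) / (2 * (2 * σ ^ 2 * ρ ^ 2))) *
        (k * Real.exp (-(normSq z - 2 * (z ⬝ᵥ (of H *ᵥ u)) + normSq (of H *ᵥ u)) / (2 * σ ^ 2)))
        = (k' * k) * Real.exp (-normSq (u + x) / (2 * (2 * σ ^ 2 * ρ ^ 2)) +
          -(normSq z - 2 * (z ⬝ᵥ (of H *ᵥ u)) + normSq (of H *ᵥ u)) / (2 * σ ^ 2)) := by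
      rw [Real.exp_add]; ring
    rw [e3, e4]
    refine mul_le_mul_of_nonneg_left (Real.exp_le_exp.2 ?_) (by positivity)
    have e5 : -(2 * normSq u + 2 * normSq x) / (2 * (2 * σ ^ 2 * ρ ^ 2))
        ≤ -normSq (u + x) / (2 * (2 * σ ^ 2 * ρ ^ 2)) :=
      div_le_div_of_nonneg_right (neg_le_neg e2) (by positivity)
    have e6 : -(2 * normSq u + 2 * normSq x) / (2 * (2 * σ ^ 2 * ρ ^ 2))
        = -(normSq u / ρ ^ 2) / (2 * σ ^ 2) - normSq x / (2 * σ ^ 2 * ρ ^ 2) := by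
      field_simp; ring
    have e7 : -(normSq z - 2 * (z ⬝ᵥ (of H *ᵥ u)) + normSq (of H *ᵥ u)) / (2 * σ ^ 2)
        = -normSq z / (2 * σ ^ 2) + t u - normSq (of H *ᵥ u) / (2 * σ ^ 2) := by
      simp only [ht]; field_simp; ring
    have e8 : -(normSq (of H *ᵥ u) + normSq u / ρ ^ 2) / (2 * σ ^ 2)
        = -(normSq u / ρ ^ 2) / (2 * σ ^ 2) - normSq (of H *ᵥ u) / (2 * σ ^ 2) := by ring
    rw [e7, e8]
    linarith
  rw [← lintegral_add_right_eq_self _ x]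
  calc ENNReal.ofReal (k * Real.exp (-normSq z / (2 * σ ^ 2)))
      = ENNReal.ofReal (√(gramDet ρ H) * (Real.exp b * √2 ^ nT)) *
        (ENNReal.ofReal (k * Real.exp (-normSq z / (2 * σ ^ 2)) * (k' * Real.exp (-b))) *
          ENNReal.ofReal ((√(Real.pi * (2 * σ ^ 2)) * ρ) ^ nT / √(gramDet ρ H))) := by
        rw [← ENNReal.ofReal_mul (by positivity), ← ENNReal.ofReal_mul (by positivity)]
        congr 1
        have hk'' : k' * (√(Real.pi * (2 * σ ^ 2)) * ρ) ^ nT * √2 ^ nT = 1 := by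
          rw [hk', ← mul_pow, ← mul_pow]
          have : √(2 * Real.pi * (2 * σ ^ 2 * ρ ^ 2)) = √(Real.pi * (2 * σ ^ 2)) * ρ * √2 := by
            rw [show 2 * Real.pi * (2 * σ ^ 2 * ρ ^ 2) = (Real.pi * (2 * σ ^ 2)) * ρ ^ 2 * 2 by ring,
              Real.sqrt_mul (by positivity), Real.sqrt_mul (by positivity), Real.sqrt_sq hρ.le]
          rw [this, mul_assoc, inv_mul_cancel₀ (by positivity), one_pow]
        have hb : Real.exp b * Real.exp (-b) = 1 := by rw [← Real.exp_add]; simp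
        have hs : √(gramDet ρ H) ≠ 0 := by positivity
        set W := (√(Real.pi * (2 * σ ^ 2)) * ρ) ^ nT
        set E := Real.exp (-normSq z / (2 * σ ^ 2))
        calc k * E = k * E * (k' * W * √2 ^ nT) * (Real.exp b * Real.exp (-b))
              * (√(gramDet ρ H) * (√(gramDet ρ H))⁻¹) := by
              rw [hk'', hb, mul_inv_cancel₀ hs]; ring
          _ = _ := by ring
    _ ≤ ENNReal.ofReal (√(gramDet ρ H) * (Real.exp b * √2 ^ nT)) *
        ∫⁻ u, ENNReal.ofReal (k * Real.exp (-normSq z / (2 * σ ^ 2)) * (k' * Real.exp (-b))) *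
          ENNReal.ofReal (Real.exp (t u) * F u) := by
        rw [lintegral_const_mul _ (by
          have : Continuous t := by rw [ht]; unfold dotProduct; fun_prop
          fun_prop)]
        gcongr
    _ ≤ _ := by
        exact mul_le_mul_right (lintegral_mono hpt) _

/-- No admissible input exceeds, up to a constant, the mutual information
`log det (1 + ρ² H Hᵀ) / 2`. -/
theorem mutualInfo_le (c : Channel nR nT) :
    ∃ K : ℝ, ∀ ρ : ℝ, 0 < ρ → ∀ p, c.Admissible ρ p → ∀ H : Fin nR → Fin nT → ℝ,
      c.mutualInfo p H ≤ ENNReal.ofReal (Real.log (gramDet ρ H) / 2 + K) := by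
  have hσ := c.σ_real_pos
  have hα := c.α_pos
  -- The peak constraint gives ‖x‖² ≤ nT (ρσ/α)², which is b times 2σ²ρ².
  set b : ℝ := nT / (2 * c.α ^ 2) with hb
  refine ⟨Real.log (Real.exp b * √2 ^ nT), fun ρ hρ p hp H => ?_⟩
  have := hp.prob
  have := isProbabilityMeasure_jointXY c p H
  set v : ℝ≥0 := 2 * c.σ ^ 2 * (ρ.toNNReal) ^ 2 with hv
  have hv0 : v ≠ 0 := by
    have := c.σ_pos
    have := Real.toNNReal_pos.2 hρ
    positivity
  have hvr : (v : ℝ) = 2 * (c.σ : ℝ) ^ 2 * ρ ^ 2 := by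
    simp [hv, hρ.le]
  set γ : Measure (Fin nT → ℝ) := Measure.pi fun _ => gaussianReal 0 v with hγ
  have hγe : γ = volume.withDensity fun x' => ENNReal.ofReal
      ((√(2 * Real.pi * (2 * (c.σ : ℝ) ^ 2 * ρ ^ 2)))⁻¹ ^ nT
            * Real.exp (-normSq x' / (2 * (2 * (c.σ : ℝ) ^ 2 * ρ ^ 2)))) := by
    rw [hγ, pi_gaussianReal_eq hv0, hvr]
  set N : Measure (Fin nR → ℝ) := (γ.prod c.noiseVec).map fun xz => (of H).mulVec xz.1 + xz.2 with hN
  have : IsProbabilityMeasure N :=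
    Measure.isProbabilityMeasure_map (measurable_addNoise H).aemeasurable
  have hD : 0 < gramDet ρ H := one_pos.trans_le (one_le_gramDet ρ H)
  set B : ℝ := √(gramDet ρ H) * (Real.exp b * √2 ^ nT) with hB
  have hBlog : Real.log B = Real.log (gramDet ρ H) / 2 + Real.log (Real.exp b * √2 ^ nT) := by
    rw [hB, Real.log_mul (by positivity) (by positivity), Real.log_sqrt hD.le]
  rw [← hBlog]
  -- Replace the true output law by N, the output law of a Gaussian input; domination can then be
  -- checked separately for each input x.
  refine (klDiv_prod_marginals_le _ N).trans (klDiv_le_of_le_smul ?_)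
  rw [fst_jointXY c p H]
  have hNT : ∀ T : Set (Fin nR → ℝ), MeasurableSet T → N T = ∫⁻ y in T, ∫⁻ x',
      ENNReal.ofReal ((√(2 * Real.pi * (2 * (c.σ : ℝ) ^ 2 * ρ ^ 2)))⁻¹ ^ nT
            * Real.exp (-normSq x' / (2 * (2 * (c.σ : ℝ) ^ 2 * ρ ^ 2)))) *
          ENNReal.ofReal ((√(2 * Real.pi * (c.σ : ℝ) ^ 2))⁻¹ ^ nR
            * Real.exp (-normSq (y - of H *ᵥ x') / (2 * (c.σ : ℝ) ^ 2))) := by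
    intro T hT
    rw [hN, Measure.map_apply (measurable_addNoise H) hT,
      Measure.prod_apply ((measurable_addNoise H) hT)]
    have h1 : ∀ x', c.noiseVec (Prod.mk x' ⁻¹' ((fun xz : (Fin nT → ℝ) × (Fin nR → ℝ) =>
        (of H).mulVec xz.1 + xz.2) ⁻¹' T)) = ∫⁻ y in T,
      ENNReal.ofReal ((√(2 * Real.pi * (c.σ : ℝ) ^ 2))⁻¹ ^ nR
        * Real.exp (-normSq (y - of H *ᵥ x') / (2 * (c.σ : ℝ) ^ 2))) :=
      fun x' => noiseVec_shift_apply c (of H *ᵥ x') hT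
    simp_rw [h1]
    have hcm : Continuous fun q : (Fin nT → ℝ) × (Fin nR → ℝ) => of H *ᵥ q.1 := by fun_prop
    rw [hγe, lintegral_withDensity_eq_lintegral_mul _ (by fun_prop)
      (Measurable.lintegral_prod_right (by fun_prop)), lintegral_lintegral_swap]
    · refine lintegral_congr fun x' => ?_
      rw [Pi.mul_apply, lintegral_const_mul _ (by fun_prop)]
    · fun_prop
  refine Measure.le_iff.2 fun S hS => ?_
  rw [Channel.jointXY, Measure.map_apply (measurable_inputOutput H) hS,
    Measure.prod_apply ((measurable_inputOutput H) hS), Measure.smul_apply, Measure.prod_apply hS,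
    smul_eq_mul, ← lintegral_const_mul _ (measurable_measure_prodMk_left hS)]
  refine lintegral_mono_ae ?_
  filter_upwards [hp.peak] with x hx
  have hxb : normSq x / (2 * (c.σ : ℝ) ^ 2 * ρ ^ 2) ≤ b := by
    have h1 : normSq x ≤ nT * (c.peak ρ) ^ 2 := by
      rw [normSq_eq_sum]
      refine (Finset.sum_le_card_nsmul _ _ (c.peak ρ ^ 2) fun i _ =>
        pow_le_pow_left₀ (hx i).1 (hx i).2 2).trans_eq (by simp)
    refine (div_le_div_of_nonneg_right h1 (by positivity)).trans_eq ?_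
    rw [hb, Channel.peak, Channel.avgPower]
    field_simp
  have hT : MeasurableSet (Prod.mk x ⁻¹' S) := measurable_prodMk_left hS
  refine (noiseVec_shift_apply c (of H *ᵥ x) hT).trans_le ?_
  rw [hNT _ hT, ← lintegral_const_mul' _ _ ENNReal.ofReal_ne_top]
  exact lintegral_mono fun y => density_le_mixture hσ hρ _ (by positivity) H hxb y

end MutualInformation

end OWC

namespace OWC

open Matrix

/-! ### Union bound for maximum-likelihood decoding -/

section ErrorProbability

variable {nR nT : ℕ}

instance (t : Turbulence) : SigmaFinite t.law := by
  unfold Turbulence.law; infer_instance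

/-- The law of one entry of the channel matrix. -/
noncomputable def Channel.entryLaw (c : Channel nR nT) (i : Fin nR) (j : Fin nT) : Measure ℝ :=
  c.turbulence.law.map fun x => Real.exp (-(c.ν * c.d i j)) * x

instance (c : Channel nR nT) (i : Fin nR) (j : Fin nT) : SigmaFinite (c.entryLaw i j) :=
  ((Homeomorph.mulLeft₀ (Real.exp (-(c.ν * c.d i j))) (Real.exp_ne_zero _)).toMeasurableEquiv).sigmaFinite_map

theorem lawH_eq (c : Channel nR nT) :
    c.lawH = Measure.pi fun i => Measure.pi fun j => c.entryLaw i j := rfl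

instance (c : Channel nR nT) (l : ℕ) : IsProbabilityMeasure (c.noise l) := by
  unfold Channel.noise; infer_instance

theorem output_apply {l : ℕ} (H : Fin nR → Fin nT → ℝ) (X : Fin nT → Fin l → ℝ) (i : Fin nR)
    (j : Fin l) : output H X i j = ∑ t, H i t * X t j := by
  simp [output, Matrix.mul_apply]

theorem likelihood_eq (c : Channel nR nT) {l : ℕ} (H : Fin nR → Fin nT → ℝ)
    (X : Fin nT → Fin l → ℝ) (Y : Fin nR → Fin l → ℝ) :
    c.likelihood H X Y = (∏ _i : Fin nR, ∏ _j : Fin l, (√(2 * Real.pi * (c.σ : ℝ) ^ 2))⁻¹) *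
      Real.exp (-(∑ i, ∑ j, (Y i j - output H X i j) ^ 2) / (2 * (c.σ : ℝ) ^ 2)) := by
  simp only [Channel.likelihood, gaussianPDFReal, Finset.prod_mul_distrib, ← Real.exp_sum]
  push_cast
  simp only [← Finset.sum_div, Finset.sum_neg_distrib]

theorem likelihood_le_iff (c : Channel nR nT) {l : ℕ} (H : Fin nR → Fin nT → ℝ)
    (X X' : Fin nT → Fin l → ℝ) (Y : Fin nR → Fin l → ℝ) :
    c.likelihood H X Y ≤ c.likelihood H X' Y ↔
      ∑ i, ∑ j, (Y i j - output H X' i j) ^ 2 ≤ ∑ i, ∑ j, (Y i j - output H X i j) ^ 2 := by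
  have hσ := c.σ_real_pos
  rw [likelihood_eq, likelihood_eq, mul_le_mul_iff_right₀ (by positivity), Real.exp_le_exp,
    div_le_div_iff_of_pos_right (by positivity), neg_le_neg_iff]

/-- The integrand is the square root of the likelihood ratio (4σ² in place of 2σ²), that is,
Chernoff's bound with parameter 1/2; the Gaussian moment generating function at -v/(2σ²) evaluates
it. -/
theorem lintegral_gaussianReal_chernoff {σ : ℝ≥0} (hσ : 0 < σ) (v : ℝ) :
    ∫⁻ z, ENNReal.ofReal (Real.exp (-((z + v) ^ 2 - z ^ 2) / (4 * (σ : ℝ) ^ 2)))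
      ∂(gaussianReal 0 (σ ^ 2)) = ENNReal.ofReal (Real.exp (-v ^ 2 / (8 * (σ : ℝ) ^ 2))) := by
  have hσ' : 0 < (σ : ℝ) := by exact_mod_cast hσ
  set t : ℝ := -v / (2 * (σ : ℝ) ^ 2) with ht
  have e : ∀ z : ℝ, Real.exp (-((z + v) ^ 2 - z ^ 2) / (4 * (σ : ℝ) ^ 2))
      = Real.exp (-v ^ 2 / (4 * (σ : ℝ) ^ 2)) * Real.exp (t * z) := by
    intro z
    rw [← Real.exp_add]
    congr 1
    rw [ht]
    field_simp
    ring
  simp_rw [e]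
  rw [← ofReal_integral_eq_lintegral_ofReal ((integrable_exp_mul_gaussianReal t).const_mul _)
    (ae_of_all _ fun x => by positivity), integral_const_mul]
  have h := congrFun (mgf_fun_id_gaussianReal (μ := 0) (v := σ ^ 2)) t
  rw [mgf] at h
  rw [h, ← Real.exp_add]
  congr 2
  push_cast
  rw [ht]
  field_simp
  ring

/-- Chernoff's bound for the probability that a wrong codeword is at least as likely as the one
that was sent. -/
theorem noise_pairwise_le (c : Channel nR nT) {l : ℕ} (H : Fin nR → Fin nT → ℝ)
    (X X' : Fin nT → Fin l → ℝ) :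
    c.noise l {z | c.likelihood H X (output H X + z) ≤ c.likelihood H X' (output H X + z)} ≤
      ENNReal.ofReal (Real.exp (-(∑ i, ∑ j, (output H X i j - output H X' i j) ^ 2)
        / (8 * (c.σ : ℝ) ^ 2))) := by
  have hσ := c.σ_real_pos
  set v : Fin nR → Fin l → ℝ := fun i j => output H X i j - output H X' i j with hv
  set ψ : Fin nR → Fin l → ℝ → ℝ≥0∞ := fun i j z =>
    ENNReal.ofReal (Real.exp (-((z + v i j) ^ 2 - z ^ 2) / (4 * (c.σ : ℝ) ^ 2))) with hψ
  have hψm : ∀ i j, Measurable (ψ i j) := fun i j => by rw [hψ]; fun_prop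
  have h1 : ∫⁻ z, ∏ i, ∏ j, ψ i j (z i j) ∂(c.noise l) = ENNReal.ofReal
      (Real.exp (-(∑ i, ∑ j, (v i j) ^ 2) / (8 * (c.σ : ℝ) ^ 2))) := by
    rw [Channel.noise, lintegral_pi_prod (f := fun i (y : Fin l → ℝ) => ∏ j, ψ i j (y j)) fun i =>
      Finset.measurable_prod _ fun j _ => (hψm i j).comp (measurable_pi_apply j)]
    have h2 : ∀ i, ∫⁻ y, ∏ j, ψ i j (y j) ∂(Measure.pi fun _ : Fin l => gaussianReal 0 (c.σ ^ 2))
        = ∏ j, ENNReal.ofReal (Real.exp (-(v i j) ^ 2 / (8 * (c.σ : ℝ) ^ 2))) := by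
      intro i
      rw [lintegral_pi_prod (hψm i)]
      exact Finset.prod_congr rfl fun j _ => lintegral_gaussianReal_chernoff c.σ_pos (v i j)
    simp_rw [h2]
    simp_rw [← ENNReal.ofReal_prod_of_nonneg fun _ _ => (Real.exp_pos _).le, ← Real.exp_sum]
    rw [← ENNReal.ofReal_prod_of_nonneg fun _ _ => (Real.exp_pos _).le, ← Real.exp_sum]
    simp only [← Finset.sum_div, Finset.sum_neg_distrib]
  rw [← h1]
  have hmeas : Measurable fun z : Fin nR → Fin l → ℝ => ∏ i, ∏ j, ψ i j (z i j) :=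
    Finset.measurable_prod _ fun i _ => Finset.measurable_prod _ fun j _ =>
      (hψm i j).comp ((measurable_pi_apply j).comp (measurable_pi_apply i))
  -- Markov's inequality: the square root of the likelihood ratio is at least 1 on the event.
  refine le_trans (measure_mono ?_) ((mul_meas_ge_le_lintegral hmeas 1).trans' (one_mul _).symm.le)
  intro z hz
  rw [Set.mem_ofPred_eq, likelihood_le_iff] at hz
  change 1 ≤ ∏ i, ∏ j, ψ i j (z i j)
  simp_rw [hψ, ← ENNReal.ofReal_prod_of_nonneg fun _ _ => (Real.exp_pos _).le, ← Real.exp_sum]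
  rw [← ENNReal.ofReal_prod_of_nonneg fun _ _ => (Real.exp_pos _).le, ← Real.exp_sum,
    ← ENNReal.ofReal_one]
  refine ENNReal.ofReal_le_ofReal ?_
  rw [Real.one_le_exp_iff]
  simp only [← Finset.sum_div, Finset.sum_neg_distrib, Finset.sum_sub_distrib]
  refine div_nonneg ?_ (by positivity)
  have e1 : ∑ i, ∑ j, ((output H X + z) i j - output H X' i j) ^ 2
      = ∑ i, ∑ j, (z i j + v i j) ^ 2 :=
    Finset.sum_congr rfl fun i _ => Finset.sum_congr rfl fun j _ => by
      simp only [Pi.add_apply, hv]; ring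
  have e2 : ∑ i, ∑ j, ((output H X + z) i j - output H X i j) ^ 2 = ∑ i, ∑ j, (z i j) ^ 2 :=
    Finset.sum_congr rfl fun i _ => Finset.sum_congr rfl fun j _ => by
      simp only [Pi.add_apply]; ring
  rw [e1, e2] at hz
  linarith

/-- The law of one random codeword. -/
noncomputable def Channel.codeword (c : Channel nR nT) (l : ℕ) (m ρ : ℝ) :
    Measure (Fin nT → Fin l → ℝ) :=
  Measure.pi fun _ => Measure.pi fun _ => truncExp (c.peak ρ) m

/-- The squared distance splits over the l columns, which are independent inputs, and each
contributes one factor C/√D. -/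
theorem lintegral_codeword_exp_le (c : Channel nR nT) (l : ℕ) (m : ℝ) :
    ∃ C : ℝ, 0 < C ∧ ∀ ρ : ℝ, 0 < ρ → ∀ (H : Fin nR → Fin nT → ℝ) (Y : Fin nR → Fin l → ℝ),
      ∫⁻ X', ENNReal.ofReal (Real.exp (-(∑ i, ∑ j, (Y i j - output H X' i j) ^ 2)
        / (8 * (c.σ : ℝ) ^ 2))) ∂(c.codeword l m ρ) ≤ ENNReal.ofReal ((C / √(gramDet ρ H)) ^ l) := by
  have hσ := c.σ_real_pos
  obtain ⟨C, hC, h⟩ := lintegral_teInput_exp_le c m (κ := 8 * (c.σ : ℝ) ^ 2) (by positivity)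
  refine ⟨C, hC, fun ρ hρ H Y => ?_⟩
  have := isProbabilityMeasure_truncExp (c.peak_pos hρ) m
  have hsw : c.codeword l m ρ = (Measure.pi fun _ : Fin l => c.teInput m ρ).map
      (fun x j i => x i j) := (map_swap_pi_pi fun (_ : Fin l) (_ : Fin nT) => truncExp (c.peak ρ) m).symm
  have := isProbabilityMeasure_teInput c m hρ
  have hfm : Measurable fun X' : Fin nT → Fin l → ℝ =>
      ENNReal.ofReal (Real.exp (-(∑ i, ∑ j, (Y i j - output H X' i j) ^ 2)
        / (8 * (c.σ : ℝ) ^ 2))) := by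
    simp_rw [output_apply]
    fun_prop
  rw [hsw, lintegral_map hfm (by fun_prop)]
  have e : ∀ x : Fin l → Fin nT → ℝ,
      ENNReal.ofReal (Real.exp (-(∑ i, ∑ j, (Y i j - output H (fun t j => x j t) i j) ^ 2)
        / (8 * (c.σ : ℝ) ^ 2))) = ∏ j, ENNReal.ofReal (Real.exp
          (-normSq ((fun i => Y i j) - of H *ᵥ x j) / (8 * (c.σ : ℝ) ^ 2))) := by
    intro x
    rw [← ENNReal.ofReal_prod_of_nonneg fun _ _ => (Real.exp_pos _).le, ← Real.exp_sum,
      ← Finset.sum_div, Finset.sum_neg_distrib, Finset.sum_comm]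
    congr 4
    refine Finset.sum_congr rfl fun j _ => ?_
    rw [normSq_eq_sum]
    refine Finset.sum_congr rfl fun i _ => ?_
    rw [output_apply]
    simp [mulVec, dotProduct]
  simp_rw [e]
  rw [lintegral_pi_prod (f := fun j (x : Fin nT → ℝ) => ENNReal.ofReal (Real.exp
          (-normSq ((fun i => Y i j) - of H *ᵥ x) / (8 * (c.σ : ℝ) ^ 2)))) fun j => by fun_prop]
  refine (Finset.prod_le_prod' fun j _ => h ρ hρ H fun i => Y i j).trans_eq ?_
  rw [Finset.prod_const, Finset.card_univ, Fintype.card_fin, ENNReal.ofReal_pow (by positivity)]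

theorem measurable_likelihood (c : Channel nR nT) {l : ℕ} {Ω : Type*} [MeasurableSpace Ω]
    {H : Ω → Fin nR → Fin nT → ℝ} {X : Ω → Fin nT → Fin l → ℝ} {Y : Ω → Fin nR → Fin l → ℝ}
    (hH : Measurable H) (hX : Measurable X) (hY : Measurable Y) :
    Measurable fun ω => c.likelihood (H ω) (X ω) (Y ω) := by
  simp_rw [likelihood_eq, output_apply]
  fun_prop

theorem measurable_output {l : ℕ} {Ω : Type*} [MeasurableSpace Ω]
    {H : Ω → Fin nR → Fin nT → ℝ} {X : Ω → Fin nT → Fin l → ℝ}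
    (hH : Measurable H) (hX : Measurable X) : Measurable fun ω => output (H ω) (X ω) := by
  refine measurable_pi_iff.2 fun i => measurable_pi_iff.2 fun j => ?_
  simp_rw [output_apply]
  fun_prop

theorem measurableSet_pairwise (c : Channel nR nT) {l M : ℕ} (k k' : Fin M) :
    MeasurableSet {ω : (Fin nR → Fin nT → ℝ) × (Fin M → Fin nT → Fin l → ℝ) × (Fin nR → Fin l → ℝ) |
      c.likelihood ω.1 (ω.2.1 k) (output ω.1 (ω.2.1 k) + ω.2.2)
        ≤ c.likelihood ω.1 (ω.2.1 k') (output ω.1 (ω.2.1 k) + ω.2.2)} := by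
  have h1 : ∀ k, Measurable fun ω : (Fin nR → Fin nT → ℝ) × (Fin M → Fin nT → Fin l → ℝ) ×
      (Fin nR → Fin l → ℝ) => ω.2.1 k := fun k => by fun_prop
  have h2 : Measurable fun ω : (Fin nR → Fin nT → ℝ) × (Fin M → Fin nT → Fin l → ℝ) ×
      (Fin nR → Fin l → ℝ) => output ω.1 (ω.2.1 k) + ω.2.2 :=
    (measurable_output measurable_fst (h1 k)).add measurable_snd.snd
  exact measurableSet_le (measurable_likelihood c measurable_fst (h1 k) h2)
    (measurable_likelihood c measurable_fst (h1 k') h2)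

theorem isProbabilityMeasure_codeword (c : Channel nR nT) (l : ℕ) (m : ℝ) {ρ : ℝ} (hρ : 0 < ρ) :
    IsProbabilityMeasure (c.codeword l m ρ) := by
  have := isProbabilityMeasure_truncExp (c.peak_pos hρ) m
  unfold Channel.codeword
  infer_instance

/-- Bound the noise probability by Chernoff for a fixed codebook, then average over the wrong
codeword alone; the sent codeword enters only through the arbitrary centre HX. -/
theorem codebook_pairwise_le (c : Channel nR nT) (l : ℕ) (m : ℝ) :
    ∃ C : ℝ, 0 < C ∧ ∀ ρ : ℝ, 0 < ρ → ∀ (M : ℕ) (H : Fin nR → Fin nT → ℝ) (k k' : Fin M), k' ≠ k →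
      ((Measure.pi fun _ : Fin M => c.codeword l m ρ).prod (c.noise l))
        {ω | c.likelihood H (ω.1 k) (output H (ω.1 k) + ω.2)
          ≤ c.likelihood H (ω.1 k') (output H (ω.1 k) + ω.2)}
        ≤ ENNReal.ofReal ((C / √(gramDet ρ H)) ^ l) := by
  obtain ⟨C, hC, h⟩ := lintegral_codeword_exp_le c l m
  refine ⟨C, hC, fun ρ hρ M H k k' hkk => ?_⟩
  have := isProbabilityMeasure_codeword c l m hρ
  have hX : ∀ k : Fin M, Measurable fun ω : (Fin M → Fin nT → Fin l → ℝ) × (Fin nR → Fin l → ℝ) =>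
      ω.1 k := fun k => (measurable_pi_apply k).comp measurable_fst
  have hY : Measurable fun ω : (Fin M → Fin nT → Fin l → ℝ) × (Fin nR → Fin l → ℝ) =>
      output H (ω.1 k) + ω.2 := (measurable_output measurable_const (hX k)).add measurable_snd
  rw [Measure.prod_apply (measurableSet_le (measurable_likelihood c measurable_const (hX k) hY)
    (measurable_likelihood c measurable_const (hX k') hY))]
  have hpre : ∀ Xs : Fin M → Fin nT → Fin l → ℝ, Prod.mk Xs ⁻¹'
      {ω : (Fin M → Fin nT → Fin l → ℝ) × (Fin nR → Fin l → ℝ) |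
        c.likelihood H (ω.1 k) (output H (ω.1 k) + ω.2)
          ≤ c.likelihood H (ω.1 k') (output H (ω.1 k) + ω.2)}
      = {z | c.likelihood H (Xs k) (output H (Xs k) + z)
          ≤ c.likelihood H (Xs k') (output H (Xs k) + z)} := fun Xs => Set.preimage_ofPred_eq
  simp_rw [hpre]
  have hchernoff : ∀ Xs : Fin M → Fin nT → Fin l → ℝ,
      c.noise l {z | c.likelihood H (Xs k) (output H (Xs k) + z)
        ≤ c.likelihood H (Xs k') (output H (Xs k) + z)} ≤ ENNReal.ofReal (Real.exp
          (-(∑ i, ∑ j, (output H (Xs k) i j - output H (Xs k') i j) ^ 2) / (8 * (c.σ : ℝ) ^ 2))) :=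
    fun Xs => noise_pairwise_le c H (Xs k) (Xs k')
  refine le_trans (lintegral_mono hchernoff) ?_
  refine lintegral_pi_le_of_forall_update ?_ k' fun Xs => ?_
  · have hO : ∀ k : Fin M, Measurable fun Xs : Fin M → Fin nT → Fin l → ℝ => output H (Xs k) :=
      fun k => measurable_output measurable_const (measurable_pi_apply k)
    have := hO k
    have := hO k'
    fun_prop
  · simp only [Function.update_self, Function.update_of_ne hkk.symm]
    exact h ρ hρ H _

/-- The union bound, with the channel matrices in a set `S` discarded. -/
theorem measure_error_le (c : Channel nR nT) (l : ℕ) (m : ℝ) :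
    ∃ C : ℝ, 0 < C ∧ ∀ ρ : ℝ, 0 < ρ → ∀ (M : ℕ) (δ : Decoder nR nT l M),
      c.IsML δ → ∀ S : Set (Fin nR → Fin nT → ℝ), MeasurableSet S → ∀ k : Fin M,
      (c.lawH.prod ((Measure.pi fun _ : Fin M => c.codeword l m ρ).prod (c.noise l)))
        {ω | δ ω.1 ω.2.1 (output ω.1 (ω.2.1 k) + ω.2.2) ≠ k} ≤ c.lawH S + ((M - 1 : ℕ) : ℝ≥0∞) *
        ∫⁻ H in Sᶜ, ENNReal.ofReal ((C / √(gramDet ρ H)) ^ l) ∂c.lawH := by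
  obtain ⟨C, hC, h⟩ := codebook_pairwise_le c l m
  refine ⟨C, hC, fun ρ hρ M δ hδ S hS k => ?_⟩
  have := isProbabilityMeasure_codeword c l m hρ
  set I := ∫⁻ H in Sᶜ, ENNReal.ofReal ((C / √(gramDet ρ H)) ^ l) ∂c.lawH with hI
  set μ := c.lawH.prod ((Measure.pi fun _ : Fin M => c.codeword l m ρ).prod (c.noise l)) with hμ
  set E : Fin M → Set ((Fin nR → Fin nT → ℝ) × (Fin M → Fin nT → Fin l → ℝ) × (Fin nR → Fin l → ℝ)) :=
    fun k' => {ω | c.likelihood ω.1 (ω.2.1 k) (output ω.1 (ω.2.1 k) + ω.2.2)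
        ≤ c.likelihood ω.1 (ω.2.1 k') (output ω.1 (ω.2.1 k) + ω.2.2)} with hE
  have hpair : ∀ k' : Fin M, k' ≠ k → μ (Prod.fst ⁻¹' Sᶜ ∩ E k') ≤ I := by
    intro k' hkk
    have hms := (measurable_fst hS.compl).inter (measurableSet_pairwise c (l := l) k k')
    rw [hμ, Measure.prod_apply hms, hI, ← lintegral_indicator hS.compl]
    refine lintegral_mono fun H => ?_
    by_cases hH : H ∈ Sᶜ
    · rw [Set.indicator_of_mem hH]
      exact (measure_mono fun ω hω => hω.2).trans (h ρ hρ M H k k' hkk)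
    · rw [Set.indicator_of_notMem hH]
      exact le_of_eq (measure_mono_null (t := ∅) (fun ω hω => hH hω.1) measure_empty)
  -- The decoder is arbitrary apart from maximum likelihood, so its error set need not be
  -- measurable; it is covered by events that are.
  have hsub : {ω | δ ω.1 ω.2.1 (output ω.1 (ω.2.1 k) + ω.2.2) ≠ k} ⊆ (S ×ˢ Set.univ) ∪
      ⋃ k' ∈ Finset.univ.erase k, (Prod.fst ⁻¹' Sᶜ ∩ E k') := by
    intro ω hω
    by_cases hS : ω.1 ∈ S
    · exact Or.inl ⟨hS, trivial⟩
    · refine Or.inr (Set.mem_biUnion (x := δ ω.1 ω.2.1 (output ω.1 (ω.2.1 k) + ω.2.2))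
        (Finset.mem_coe.2 (Finset.mem_erase.2 ⟨hω, Finset.mem_univ _⟩)) ⟨hS, ?_⟩)
      exact hδ ω.1 ω.2.1 _ k
  refine (measure_mono hsub).trans ((measure_union_le _ _).trans (add_le_add ?_ ?_))
  · rw [hμ, Measure.prod_prod, measure_univ, mul_one]
  · refine (measure_biUnion_finset_le _ _).trans ((Finset.sum_le_card_nsmul _ _ I fun k' hk' =>
      hpair k' (Finset.ne_of_mem_erase hk')).trans_eq ?_)
    rw [nsmul_eq_mul, Finset.card_erase_of_mem (Finset.mem_univ k), Finset.card_univ,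
      Fintype.card_fin]

/-- The union bound counts only the wrong codewords, and this missing one absorbs the rounding up.
-/
theorem codeSize_sub_one_le (l : ℕ) (r : ℝ) {ρ : ℝ} (hρ : 0 < ρ) :
    ((codeSize l r ρ - 1 : ℕ) : ℝ≥0∞) ≤ ENNReal.ofReal (ρ ^ ((l : ℝ) * r)) := by
  have hpos : 0 ≤ ρ ^ ((l : ℝ) * r) := (Real.rpow_pos_of_pos hρ _).le
  rw [← ENNReal.ofReal_natCast]
  refine ENNReal.ofReal_le_ofReal ?_
  rw [codeSize, Nat.cast_sub (le_max_left _ _), Nat.cast_one, sub_le_iff_le_add, Nat.cast_max]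
  exact max_le (by simpa using hpos) (Nat.ceil_lt_add_one hpos).le

theorem Pe_le (c : Channel nR nT) (l : ℕ) (m : ℝ) :
    ∃ C : ℝ, 0 < C ∧ ∀ ρ : ℝ, 0 < ρ → ∀ (r : ℝ) (δ : Decoder nR nT l (codeSize l r ρ)),
      c.IsML δ → ∀ S : Set (Fin nR → Fin nT → ℝ), MeasurableSet S →
      c.Pe l m r ρ δ ≤ c.lawH S + ENNReal.ofReal (ρ ^ ((l : ℝ) * r)) *
        ∫⁻ H in Sᶜ, ENNReal.ofReal ((C / √(gramDet ρ H)) ^ l) ∂c.lawH := by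
  obtain ⟨C, hC, h⟩ := measure_error_le c l m
  refine ⟨C, hC, fun ρ hρ r δ hδ S hS => ENNReal.div_le_of_le_mul ?_⟩
  refine (Finset.sum_le_card_nsmul _ _ _ fun k _ => (h ρ hρ _ δ hδ S hS k).trans
    (add_le_add le_rfl (mul_le_mul_left (codeSize_sub_one_le l r hρ) _))).trans_eq ?_
  rw [nsmul_eq_mul, Finset.card_univ, Fintype.card_fin, mul_comm]

end ErrorProbability

end OWC

namespace OWC

/-! ### Convergence and monotonicity of the Bessel function -/

section BesselFunction

/-- Gaussian domination from cosh t ≥ t²/4 and cosh(τt) ≤ exp(|τ|t), after completing the square.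
Without integrability the Bochner integral defaults to 0 and could not be compared monotonically. -/
theorem integrableOn_besselK (τ : ℝ) {x : ℝ} (hx : 0 < x) :
    IntegrableOn (fun t => Real.exp (-x * Real.cosh t) * Real.cosh (τ * t)) (Set.Ioi 0) := by
  have hdom : IntegrableOn (fun t : ℝ => Real.exp (2 * τ ^ 2 / x) * Real.exp (-(x / 8) * t ^ 2))
      (Set.Ioi 0) := ((integrable_exp_neg_mul_sq (by positivity)).const_mul _).integrableOn
  refine Integrable.mono' hdom (Continuous.aestronglyMeasurable (by
    have := Real.continuous_cosh; fun_prop)) ?_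
  refine (ae_restrict_iff' measurableSet_Ioi).2 (ae_of_all _ fun t ht => ?_)
  have ht0 : 0 ≤ t := le_of_lt ht
  have h1 : t ^ 2 / 4 ≤ Real.cosh t := by
    have := Real.quadratic_le_exp_of_nonneg ht0
    have := Real.exp_pos (-t)
    rw [Real.cosh_eq]
    linarith
  have h2 : Real.cosh (τ * t) ≤ Real.exp (|τ| * t) := by
    rw [← Real.cosh_abs, abs_mul, abs_of_nonneg ht0, Real.cosh_eq]
    have : Real.exp (-(|τ| * t)) ≤ Real.exp (|τ| * t) := Real.exp_le_exp.2 (by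
      have := mul_nonneg (abs_nonneg τ) ht0
      linarith)
    linarith
  rw [Real.norm_of_nonneg (mul_nonneg (Real.exp_pos _).le (Real.cosh_pos _).le)]
  calc Real.exp (-x * Real.cosh t) * Real.cosh (τ * t)
      ≤ Real.exp (-x * (t ^ 2 / 4)) * Real.exp (|τ| * t) := by
        refine mul_le_mul (Real.exp_le_exp.2 ?_) h2 (Real.cosh_pos _).le (Real.exp_pos _).le
        nlinarith
    _ = Real.exp (-x * (t ^ 2 / 4) + |τ| * t) := (Real.exp_add _ _).symm
    _ ≤ Real.exp (2 * τ ^ 2 / x + -(x / 8) * t ^ 2) := by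
        refine Real.exp_le_exp.2 ?_
        have h3 : 0 ≤ (x * t - 4 * |τ|) ^ 2 / (8 * x) := by positivity
        have h4 : (x * t - 4 * |τ|) ^ 2 / (8 * x) = x / 8 * t ^ 2 - |τ| * t + 2 * τ ^ 2 / x := by
          rw [← sq_abs τ]
          field_simp
          ring
        linarith
    _ = _ := Real.exp_add _ _

theorem besselK_anti (τ : ℝ) {x y : ℝ} (hx : 0 < x) (hxy : x ≤ y) : besselK τ y ≤ besselK τ x := by
  refine setIntegral_mono_on (integrableOn_besselK τ (hx.trans_le hxy))
    (integrableOn_besselK τ hx) measurableSet_Ioi fun t _ => ?_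
  refine mul_le_mul_of_nonneg_right (Real.exp_le_exp.2 ?_) (Real.cosh_pos _).le
  have := Real.cosh_pos t
  nlinarith

end BesselFunction

/-! ### Effect of a dilation on the law of the channel matrix -/

section Scaling

theorem pdf_negExp_le {s : ℝ} (hs1 : s < 1) {x : ℝ} (hx : 0 < x) :
    Turbulence.negExp.pdf x ≤ 1 * Turbulence.negExp.pdf (s * x) := by
  simp only [Turbulence.pdf, one_mul]
  refine Real.exp_le_exp.2 ?_
  nlinarith

/-- The Bessel factor decreases in x, so only the power of x pays for the dilation. -/
theorem pdf_gammaGamma_le {ρ₁ ρ₂ : ℝ} (h0 : 0 < ρ₂) (h1 : ρ₂ < ρ₁) {s : ℝ} (hs : 0 < s)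
    (hs1 : s < 1) {x : ℝ} (hx : 0 < x) :
    (Turbulence.gammaGamma ρ₁ ρ₂ h0 h1).pdf x
      ≤ s ^ (-((ρ₁ + ρ₂) / 2 - 1)) * (Turbulence.gammaGamma ρ₁ ρ₂ h0 h1).pdf (s * x) := by
  have hρ₁ : 0 < ρ₁ := h0.trans h1
  simp only [Turbulence.pdf]
  set q := (ρ₁ + ρ₂) / 2 - 1
  set A := 2 * (ρ₁ * ρ₂) ^ ((ρ₁ + ρ₂) / 2) / (Real.Gamma ρ₁ * Real.Gamma ρ₂)
  have hA : 0 ≤ A := by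
    have := Real.Gamma_pos_of_pos hρ₁
    have := Real.Gamma_pos_of_pos h0
    positivity
  have hb : besselK (ρ₁ - ρ₂) (2 * √(ρ₁ * ρ₂ * x)) ≤ besselK (ρ₁ - ρ₂) (2 * √(ρ₁ * ρ₂ * (s * x))) := by
    refine besselK_anti _ (by positivity) ?_
    have : ρ₁ * ρ₂ * (s * x) ≤ ρ₁ * ρ₂ * x := by
      refine mul_le_mul_of_nonneg_left ?_ (by positivity)
      nlinarith
    have := Real.sqrt_le_sqrt this
    linarith
  have hx' : s ^ (-q) * (s * x) ^ q = x ^ q := by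
    rw [Real.mul_rpow hs.le hx.le, ← mul_assoc, ← Real.rpow_add hs]
    simp
  calc A * x ^ q * besselK (ρ₁ - ρ₂) (2 * √(ρ₁ * ρ₂ * x))
      ≤ A * x ^ q * besselK (ρ₁ - ρ₂) (2 * √(ρ₁ * ρ₂ * (s * x))) :=
        mul_le_mul_of_nonneg_left hb (by positivity)
    _ = s ^ (-q) * (A * (s * x) ^ q * besselK (ρ₁ - ρ₂) (2 * √(ρ₁ * ρ₂ * (s * x)))) := by
        rw [← hx']; ring

/-- The log-ratio of the densities contains (log s)(log x)/σl², unbounded as x → 0. Hence the cutoff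
τ and a constant that is a power of τ. -/
theorem pdf_logNormal_le {μl σl : ℝ} (h0 : 0 < σl) {s : ℝ} (hs : 0 < s) (hs1 : s < 1) {τ x : ℝ}
    (hτ : 0 < τ) (hx : τ ≤ x) :
    (Turbulence.logNormal μl σl h0).pdf x
      ≤ Real.exp ((2 * -Real.log s * μl + Real.log s ^ 2) / (2 * σl ^ 2)) * τ ^ (Real.log s / σl ^ 2)
        * (Turbulence.logNormal μl σl h0).pdf (s * x) := by
  have hx0 : 0 < x := hτ.trans_le hx
  have hls : Real.log s < 0 := Real.log_neg hs hs1
  simp only [Turbulence.pdf]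
  rw [Real.log_mul hs.ne' hx0.ne', Real.rpow_def_of_pos hτ, ← Real.exp_add]
  set u := Real.log x with hu
  have hlog : Real.log τ ≤ u := Real.log_le_log hτ hx
  have hx1 : 1 / (x * √(2 * Real.pi * σl ^ 2)) ≤ 1 / (s * x * √(2 * Real.pi * σl ^ 2)) := by
    refine one_div_le_one_div_of_le (by positivity) ?_
    refine mul_le_mul_of_nonneg_right ?_ (by positivity)
    nlinarith
  have hexp : Real.exp (-(u - μl) ^ 2 / (2 * σl ^ 2)) ≤
      Real.exp ((2 * -Real.log s * μl + Real.log s ^ 2) / (2 * σl ^ 2) + Real.log τ * (Real.log s / σl ^ 2))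
        * Real.exp (-(Real.log s + u - μl) ^ 2 / (2 * σl ^ 2)) := by
    rw [← Real.exp_add]
    refine Real.exp_le_exp.2 ?_
    have e : (2 * -Real.log s * μl + Real.log s ^ 2) / (2 * σl ^ 2)
        + Real.log τ * (Real.log s / σl ^ 2) + -(Real.log s + u - μl) ^ 2 / (2 * σl ^ 2)
        - (-(u - μl) ^ 2 / (2 * σl ^ 2)) = (u - Real.log τ) * (-Real.log s) / σl ^ 2 := by
      field_simp
      ring
    have : 0 ≤ (u - Real.log τ) * (-Real.log s) / σl ^ 2 :=
      div_nonneg (mul_nonneg (by linarith) (by linarith)) (by positivity)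
    linarith
  calc _ ≤ 1 / (s * x * √(2 * Real.pi * σl ^ 2)) * (Real.exp ((2 * -Real.log s * μl + Real.log s ^ 2)
        / (2 * σl ^ 2) + Real.log τ * (Real.log s / σl ^ 2))
        * Real.exp (-(Real.log s + u - μl) ^ 2 / (2 * σl ^ 2))) :=
        mul_le_mul hx1 hexp (Real.exp_pos _).le (by positivity)
    _ = _ := by ring

/-- The quadratic in log x beats any linear term. Large q makes the mass below the cutoff
superpolynomially small; q = -2 gives integrability at infinity. -/
theorem pdf_logNormal_le_rpow {μl σl : ℝ} (h0 : 0 < σl) (q : ℝ) :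
    ∃ C : ℝ, 0 < C ∧ ∀ x, 0 < x → (Turbulence.logNormal μl σl h0).pdf x ≤ C * x ^ q := by
  refine ⟨1 / √(2 * Real.pi * σl ^ 2) * Real.exp (-(q + 1) * μl + (q + 1) ^ 2 * σl ^ 2 / 2),
    by positivity, fun x hx => ?_⟩
  simp only [Turbulence.pdf]
  set u := Real.log x with hu
  have hxu : x = Real.exp u := (Real.exp_log hx).symm
  set w := √(2 * Real.pi * σl ^ 2) with hw
  have hw0 : 0 < w := by positivity
  rw [Real.rpow_def_of_pos hx, ← hu]
  have e1 : 1 / (x * w) = 1 / w * Real.exp (-u) := by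
    rw [Real.exp_neg, ← hxu]
    field_simp
  rw [e1, mul_assoc, mul_assoc, ← Real.exp_add, ← Real.exp_add]
  refine mul_le_mul_of_nonneg_left (Real.exp_le_exp.2 ?_) (by positivity)
  have h2 : 0 ≤ ((u - μl) / σl + (q + 1) * σl) ^ 2 / 2 := by positivity
  have h3 : ((u - μl) / σl + (q + 1) * σl) ^ 2 / 2
      = (u - μl) ^ 2 / (2 * σl ^ 2) + (q + 1) * (u - μl) + (q + 1) ^ 2 * σl ^ 2 / 2 := by
    field_simp
    ring
  have h4 : -(u - μl) ^ 2 / (2 * σl ^ 2) = -((u - μl) ^ 2 / (2 * σl ^ 2)) := by ring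
  rw [h4]
  linarith

theorem law_apply (t : Turbulence) {A : Set ℝ} (hA : MeasurableSet A) :
    t.law A = ∫⁻ x, A.indicator (fun x => (Set.Ioi (0 : ℝ)).indicator
      (fun x => ENNReal.ofReal (t.pdf x)) x) x := by
  rw [Turbulence.law, withDensity_apply _ hA, lintegral_indicator hA,
    Measure.restrict_restrict hA, lintegral_indicator measurableSet_Ioi,
    Measure.restrict_restrict measurableSet_Ioi, Set.inter_comm]

theorem law_logNormal_Iio_le {μl σl : ℝ} (h0 : 0 < σl) {q : ℝ} (hq : 0 ≤ q) :
    ∃ C : ℝ, 0 < C ∧ ∀ τ, 0 < τ → τ ≤ 1 →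
      (Turbulence.logNormal μl σl h0).law (Set.Iio τ) ≤ ENNReal.ofReal (C * τ ^ q) := by
  obtain ⟨C, hC, h⟩ := pdf_logNormal_le_rpow (μl := μl) h0 q
  refine ⟨C, hC, fun τ hτ hτ1 => ?_⟩
  rw [law_apply _ measurableSet_Iio]
  calc _ ≤ ∫⁻ x, (Set.Ioo 0 τ).indicator (fun _ => ENNReal.ofReal (C * τ ^ q)) x := by
        refine lintegral_mono fun x => ?_
        by_cases hx : x < τ
        · by_cases hx0 : 0 < x
          · rw [Set.indicator_of_mem (show x ∈ Set.Iio τ from hx),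
              Set.indicator_of_mem (show x ∈ Set.Ioi 0 from hx0),
              Set.indicator_of_mem (show x ∈ Set.Ioo 0 τ from ⟨hx0, hx⟩)]
            exact ENNReal.ofReal_le_ofReal ((h x hx0).trans (mul_le_mul_of_nonneg_left
              (Real.rpow_le_rpow hx0.le hx.le hq) hC.le))
          · rw [Set.indicator_of_mem (show x ∈ Set.Iio τ from hx),
              Set.indicator_of_notMem (show x ∉ Set.Ioi 0 from hx0)]
            exact zero_le
        · rw [Set.indicator_of_notMem (show x ∉ Set.Iio τ from hx)]
          exact zero_le
    _ = ENNReal.ofReal (C * τ ^ q) * ENNReal.ofReal τ := by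
        rw [lintegral_indicator_const measurableSet_Ioo, Real.volume_Ioo, sub_zero]
    _ ≤ ENNReal.ofReal (C * τ ^ q) := by
        refine mul_le_of_le_one_right' ?_
        rwa [ENNReal.ofReal_le_one]

theorem isFiniteMeasure_law_logNormal {μl σl : ℝ} (h0 : 0 < σl) :
    IsFiniteMeasure (Turbulence.logNormal μl σl h0).law := by
  refine ⟨?_⟩
  obtain ⟨C, hC, h⟩ := pdf_logNormal_le_rpow (μl := μl) h0 (-2)
  obtain ⟨C', hC', h'⟩ := law_logNormal_Iio_le (μl := μl) h0 (q := 0) le_rfl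
  have hcov : (Set.univ : Set ℝ) ⊆ Set.Iio 1 ∪ Set.Ici 1 := by simp
  refine (measure_mono hcov).trans_lt ((measure_union_le _ _).trans_lt (ENNReal.add_lt_top.2
    ⟨(h' 1 one_pos le_rfl).trans_lt ENNReal.ofReal_lt_top, ?_⟩))
  rw [Turbulence.law, withDensity_apply _ measurableSet_Ici, Measure.restrict_restrict measurableSet_Ici]
  have hint : IntegrableOn (fun x : ℝ => C * x ^ (-2 : ℝ)) (Set.Ici 1) := by
    rw [integrableOn_Ici_iff_integrableOn_Ioi]
    exact (integrableOn_Ioi_rpow_of_lt (by norm_num) one_pos).const_mul C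
  have hs : Set.Ici (1 : ℝ) ∩ Set.Ioi 0 = Set.Ici 1 := by
    ext x
    simp only [Set.mem_inter_iff, Set.mem_Ici, Set.mem_Ioi, and_iff_left_iff_imp]
    intro hx; linarith
  rw [hs]
  refine lt_of_le_of_lt (setLIntegral_mono' measurableSet_Ici fun x hx =>
    ENNReal.ofReal_le_ofReal (h x (one_pos.trans_le hx))) ?_
  exact hint.lintegral_lt_top

theorem law_inter_le {t : Turbulence} {s C : ℝ} (hs : 0 < s) (hC : 0 ≤ C) {U : Set ℝ}
    (hU : MeasurableSet U) (h : ∀ x ∈ U, 0 < x → t.pdf x ≤ C * t.pdf (s * x)) {A : Set ℝ}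
    (hA : MeasurableSet A) :
    t.law (A ∩ U) ≤ ENNReal.ofReal (C / s) * t.law ((fun x => s⁻¹ * x) ⁻¹' A) := by
  have hA' : MeasurableSet ((fun x => s⁻¹ * x) ⁻¹' A) := (measurable_const_mul s⁻¹) hA
  rw [law_apply t (hA.inter hU), law_apply t hA']
  set F : ℝ → ℝ≥0∞ := fun y => ((fun x => s⁻¹ * x) ⁻¹' A).indicator (fun x =>
    (Set.Ioi (0 : ℝ)).indicator (fun x => ENNReal.ofReal (t.pdf x)) x) y with hF
  calc _ ≤ ∫⁻ x, ENNReal.ofReal C * F (s * x) := by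
        refine lintegral_mono fun x => ?_
        by_cases hx : x ∈ A ∩ U
        · by_cases hx0 : 0 < x
          · have h1 : s * x ∈ (fun x => s⁻¹ * x) ⁻¹' A := by
              simpa [inv_mul_cancel_left₀ hs.ne'] using hx.1
            rw [Set.indicator_of_mem hx, Set.indicator_of_mem (show x ∈ Set.Ioi 0 from hx0), hF]
            dsimp only
            rw [Set.indicator_of_mem h1,
              Set.indicator_of_mem (show s * x ∈ Set.Ioi 0 from mul_pos hs hx0),
              ← ENNReal.ofReal_mul hC]
            exact ENNReal.ofReal_le_ofReal (h x hx.2 hx0)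
          · rw [Set.indicator_of_mem hx, Set.indicator_of_notMem (show x ∉ Set.Ioi 0 from hx0)]
            exact zero_le
        · rw [Set.indicator_of_notMem hx]
          exact zero_le
    _ = ENNReal.ofReal C * ∫⁻ x, F (s * x) := lintegral_const_mul' _ _ ENNReal.ofReal_ne_top
    _ = ENNReal.ofReal C * (ENNReal.ofReal s⁻¹ * ∫⁻ y, F y) := by
        congr 1
        have h1 := lintegral_map_equiv F (Homeomorph.mulLeft₀ s hs.ne').toMeasurableEquiv
          (μ := (volume : Measure ℝ))
        have h2 : Measure.map (Homeomorph.mulLeft₀ s hs.ne').toMeasurableEquiv (volume : Measure ℝ)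
            = ENNReal.ofReal s⁻¹ • volume := by
          rw [← abs_of_pos (inv_pos.2 hs), ← Real.map_volume_mul_left hs.ne']
          rfl
        rw [h2, lintegral_smul_measure, smul_eq_mul] at h1
        exact h1.symm
    _ = _ := by rw [← mul_assoc, ← ENNReal.ofReal_mul hC, div_eq_mul_inv]

variable {nR nT : ℕ}

/-- Comparison of the law of the channel matrix, restricted to a box, with its image under a
dilation. -/
theorem lawH_inter_box_le (c : Channel nR nT) {s C : ℝ} (hs : 0 < s) (hC : 0 < C) {U : Set ℝ}
    (hU : MeasurableSet U) (h : ∀ x ∈ U, 0 < x → c.turbulence.pdf x ≤ C * c.turbulence.pdf (s * x))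
    {S : Set (Fin nR → Fin nT → ℝ)} (hS : MeasurableSet S) :
    c.lawH (S ∩ {H | ∀ i j, (Real.exp (-(c.ν * c.d i j)))⁻¹ * H i j ∈ U})
      ≤ ENNReal.ofReal ((C / s) ^ (nR * nT)) * c.lawH ((fun H i j => s⁻¹ * H i j) ⁻¹' S) := by
  set V : Fin nR → Fin nT → Set ℝ := fun i j => (fun y => (Real.exp (-(c.ν * c.d i j)))⁻¹ * y) ⁻¹' U
    with hV
  have hVm : ∀ i j, MeasurableSet (V i j) := fun i j => (measurable_const_mul _) hU
  set K : ℝ≥0 := (C / s).toNNReal with hK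
  have hK0 : K ≠ 0 := (Real.toNNReal_pos.2 (by positivity)).ne'
  have hsm : Measurable fun x : ℝ => s⁻¹ * x := measurable_const_mul s⁻¹
  have hsf : ∀ i j, SigmaFinite ((c.entryLaw i j).map fun x => s⁻¹ * x) := fun i j =>
    ((Homeomorph.mulLeft₀ s⁻¹ (inv_ne_zero hs.ne')).toMeasurableEquiv).sigmaFinite_map
  have hentry : ∀ i j, (c.entryLaw i j).restrict (V i j)
      ≤ (K : ℝ≥0∞) • (c.entryLaw i j).map fun x => s⁻¹ * x := by
    intro i j
    refine Measure.le_iff.2 fun A hA => ?_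
    have hm : Measurable fun x : ℝ => Real.exp (-(c.ν * c.d i j)) * x := measurable_const_mul _
    rw [Measure.restrict_apply hA, Measure.smul_apply, Measure.map_apply hsm hA, Channel.entryLaw,
      Measure.map_apply hm (hA.inter (hVm i j)), Measure.map_apply hm (hsm hA), smul_eq_mul]
    have e1 : (fun x : ℝ => Real.exp (-(c.ν * c.d i j)) * x) ⁻¹' (A ∩ V i j)
        = ((fun x : ℝ => Real.exp (-(c.ν * c.d i j)) * x) ⁻¹' A) ∩ U := by
      ext x
      simp [hV]
    have e2 : (fun x : ℝ => Real.exp (-(c.ν * c.d i j)) * x) ⁻¹' ((fun x => s⁻¹ * x) ⁻¹' A)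
        = (fun x => s⁻¹ * x) ⁻¹' ((fun x : ℝ => Real.exp (-(c.ν * c.d i j)) * x) ⁻¹' A) := by
      ext x
      simp only [Set.mem_preimage]
      rw [mul_left_comm]
    rw [e1, e2]
    exact law_inter_le hs hC.le hU h (hm hA)
  have hrow : ∀ i, Measure.pi (fun j => (c.entryLaw i j).restrict (V i j)) ≤
      ((∏ _j : Fin nT, K : ℝ≥0) : ℝ≥0∞) • (Measure.pi (c.entryLaw i)).map fun x j => s⁻¹ * x j := by
    intro i
    rw [Measure.pi_map_pi (μ := c.entryLaw i) (f := fun _ x => s⁻¹ * x) fun _ => hsm.aemeasurable]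
    exact pi_le_smul_pi (fun _ => hK0) (hentry i)
  have hrsf : ∀ i, SigmaFinite ((Measure.pi (c.entryLaw i)).map fun x j => s⁻¹ * x j) := by
    intro i
    rw [Measure.pi_map_pi (μ := c.entryLaw i) (f := fun _ x => s⁻¹ * x) fun _ => hsm.aemeasurable]
    infer_instance
  have hall : Measure.pi (fun i => Measure.pi fun j => (c.entryLaw i j).restrict (V i j)) ≤
      ((∏ _i : Fin nR, ∏ _j : Fin nT, K : ℝ≥0) : ℝ≥0∞) • c.lawH.map fun H i j => s⁻¹ * H i j := by
    rw [lawH_eq, Measure.pi_map_pi (μ := fun i => Measure.pi (c.entryLaw i))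
      (f := fun _ x j => s⁻¹ * x j) fun _ =>
        (show Measurable fun (x : Fin nT → ℝ) j => s⁻¹ * x j by fun_prop).aemeasurable]
    exact pi_le_smul_pi (fun _ => Finset.prod_ne_zero_iff.2 fun _ _ => hK0) hrow
  have hres : Measure.pi (fun i => Measure.pi fun j => (c.entryLaw i j).restrict (V i j))
      = c.lawH.restrict (Set.univ.pi fun i => Set.univ.pi (V i)) := by
    rw [lawH_eq, Measure.restrict_pi_pi]
    simp_rw [Measure.restrict_pi_pi]
  have hbox : {H : Fin nR → Fin nT → ℝ | ∀ i j, (Real.exp (-(c.ν * c.d i j)))⁻¹ * H i j ∈ U}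
      = Set.univ.pi fun i => Set.univ.pi (V i) := by
    ext H
    simp [hV, Set.mem_pi]
  have hprod : ((∏ _i : Fin nR, ∏ _j : Fin nT, K : ℝ≥0) : ℝ≥0∞)
      = ENNReal.ofReal ((C / s) ^ (nR * nT)) := by
    simp only [Finset.prod_const, Finset.card_univ, Fintype.card_fin]
    rw [← pow_mul, mul_comm nT, hK, ← Real.toNNReal_pow (by positivity)]
    rfl
  have := hall S
  rw [hres, Measure.restrict_apply hS, Measure.smul_apply, Measure.map_apply (by fun_prop) hS,
    hprod, ← hbox] at this
  exact this

/-- The constant is the product of the masses of the other entries. Finiteness of the turbulence law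
is enough; its normalisation is never needed. -/
theorem exists_lawH_entry_le (c : Channel nR nT) [IsFiniteMeasure c.turbulence.law] (i : Fin nR)
    (j : Fin nT) : ∃ K : ℝ≥0, ∀ W : Set ℝ, MeasurableSet W →
      c.lawH {H | H i j ∈ W} ≤ K * c.entryLaw i j W := by
  have : ∀ i j, IsFiniteMeasure (c.entryLaw i j) := fun i j => by
    unfold Channel.entryLaw; infer_instance
  set K₁ : ℝ≥0∞ := ∏ i' ∈ Finset.univ.erase i, (Measure.pi (c.entryLaw i')) Set.univ
  set K₂ : ℝ≥0∞ := ∏ j' ∈ Finset.univ.erase j, c.entryLaw i j' Set.univ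
  have hK₁ : K₁ ≠ ∞ := ENNReal.prod_ne_top fun _ _ => measure_ne_top _ _
  have hK₂ : K₂ ≠ ∞ := ENNReal.prod_ne_top fun _ _ => measure_ne_top _ _
  refine ⟨(K₁ * K₂).toNNReal, fun W hW => le_of_eq ?_⟩
  rw [ENNReal.coe_toNNReal (ENNReal.mul_ne_top hK₁ hK₂)]
  have h1 : {H : Fin nR → Fin nT → ℝ | H i j ∈ W} = Function.eval i ⁻¹' (Function.eval j ⁻¹' W) := rfl
  have hm : MeasurableSet (Function.eval j ⁻¹' W : Set (Fin nT → ℝ)) := (measurable_pi_apply j) hW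
  rw [h1, lawH_eq, ← Measure.map_apply (measurable_pi_apply i) hm, Measure.pi_map_eval,
    Measure.smul_apply, ← Measure.map_apply (measurable_pi_apply j) hW, Measure.pi_map_eval,
    Measure.smul_apply, smul_eq_mul, smul_eq_mul, mul_assoc]

/-- A fixed dilation changes the probabilities of events about the channel matrix only by a
subpolynomial factor, up to a superpolynomially small term. -/
theorem lawH_dilation_le (c : Channel nR nT) {s : ℝ} (hs : 0 < s) (hs1 : s < 1) {δ N : ℝ} (hδ : 0 < δ)
    (hN : 0 < N) : ∃ C : ℝ, 0 < C ∧ ∀ ρ : ℝ, 1 ≤ ρ → ∀ S : Set (Fin nR → Fin nT → ℝ),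
      MeasurableSet S → c.lawH S ≤ ENNReal.ofReal (C * ρ ^ δ) *
        c.lawH ((fun H i j => s⁻¹ * H i j) ⁻¹' S) + ENNReal.ofReal (C * ρ ^ (-N)) := by
  have easy : ∀ C : ℝ, 0 < C → (∀ x, 0 < x → c.turbulence.pdf x ≤ C * c.turbulence.pdf (s * x)) →
      ∃ C : ℝ, 0 < C ∧ ∀ ρ : ℝ, 1 ≤ ρ → ∀ S : Set (Fin nR → Fin nT → ℝ),
      MeasurableSet S → c.lawH S ≤ ENNReal.ofReal (C * ρ ^ δ) *
        c.lawH ((fun H i j => s⁻¹ * H i j) ⁻¹' S) + ENNReal.ofReal (C * ρ ^ (-N)) := by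
    intro C hC h
    refine ⟨(C / s) ^ (nR * nT), by positivity, fun ρ hρ S hS => ?_⟩
    have h1 := lawH_inter_box_le c hs hC MeasurableSet.univ (fun x _ hx => h x hx) hS
    have h2 : S ∩ {H : Fin nR → Fin nT → ℝ | ∀ i j,
        (Real.exp (-(c.ν * c.d i j)))⁻¹ * H i j ∈ (Set.univ : Set ℝ)} = S := by
      ext H; simp
    rw [h2] at h1
    refine h1.trans (le_add_right (mul_le_mul_left (ENNReal.ofReal_le_ofReal ?_) _))
    exact le_mul_of_one_le_right (by positivity) (Real.one_le_rpow hρ hδ.le)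
  cases ht : c.turbulence with
  | negExp => exact easy 1 one_pos fun x hx => by rw [ht]; exact pdf_negExp_le hs1 hx
  | gammaGamma ρ₁ ρ₂ h0 h1 =>
    exact easy _ (Real.rpow_pos_of_pos hs _) fun x hx => by
      rw [ht]; exact pdf_gammaGamma_le h0 h1 hs hs1 hx
  | logNormal μl σl h0 =>
    clear easy
    have hfin : IsFiniteMeasure c.turbulence.law := by
      rw [ht]; exact isFiniteMeasure_law_logNormal h0
    have hls : 0 < -Real.log s := by linarith [Real.log_neg hs hs1]
    have hls0 : Real.log s ≠ 0 := by linarith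
    -- The cutoff τ = ρ^(-ε) is chosen so that one entry costs a factor ρ^(δ/n), hence all nR·nT
    -- entries at most ρ^δ; the +1 only keeps n positive.
    set n : ℝ := (nR * nT : ℕ) + 1 with hn
    have hn0 : 0 < n := by positivity
    set ε : ℝ := δ * σl ^ 2 / (-Real.log s * n) with hε
    have hε0 : 0 < ε := by positivity
    -- With this power, τ^(N/ε) = ρ^(-N).
    obtain ⟨C₁, hC₁, h₁⟩ := law_logNormal_Iio_le (μl := μl) h0 (q := N / ε) (by positivity)
    choose K hK using fun i j => exists_lawH_entry_le c i j
    set C₀ := Real.exp ((2 * -Real.log s * μl + Real.log s ^ 2) / (2 * σl ^ 2)) with hC₀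
    set C₂ : ℝ := ∑ i, ∑ j, (K i j : ℝ) * C₁ with hC₂
    have hC₂0 : 0 ≤ C₂ := by positivity
    refine ⟨(C₀ / s) ^ (nR * nT) + C₂, by positivity, fun ρ hρ S hS => ?_⟩
    have hρ0 : 0 < ρ := one_pos.trans_le hρ
    set τ : ℝ := ρ ^ (-ε) with hτ
    have hτ0 : 0 < τ := Real.rpow_pos_of_pos hρ0 _
    have hτ1 : τ ≤ 1 := Real.rpow_le_one_of_one_le_of_nonpos hρ (by linarith)
    set C : ℝ := C₀ * τ ^ (Real.log s / σl ^ 2) with hC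
    have hC0 : 0 < C := by positivity
    have hmain := lawH_inter_box_le c hs hC0 (measurableSet_Ici (a := τ))
      (fun x hx _ => by rw [ht]; exact pdf_logNormal_le h0 hs hs1 hτ0 hx) hS
    have hCpow : (C / s) ^ (nR * nT) ≤ ((C₀ / s) ^ (nR * nT) + C₂) * ρ ^ δ := by
      have e1 : τ ^ (Real.log s / σl ^ 2) = ρ ^ (δ / n) := by
        rw [hτ, ← Real.rpow_mul hρ0.le, hε]
        congr 1
        field_simp
      have e2 : (C / s) ^ (nR * nT) = (C₀ / s) ^ (nR * nT) * (ρ ^ (δ / n)) ^ (nR * nT) := by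
        rw [← mul_pow, hC, e1]; congr 1; ring
      have e3 : (ρ ^ (δ / n)) ^ (nR * nT) ≤ ρ ^ δ := by
        rw [← Real.rpow_natCast, ← Real.rpow_mul hρ0.le]
        refine Real.rpow_le_rpow_of_exponent_le hρ ?_
        rw [div_mul_eq_mul_div, div_le_iff₀ hn0]
        refine mul_le_mul_of_nonneg_left ?_ hδ.le
        rw [hn]; linarith
      rw [e2]
      exact mul_le_mul (by linarith) e3 (by positivity) (by positivity)
    have hbad : c.lawH {H | ¬ ∀ i j, (Real.exp (-(c.ν * c.d i j)))⁻¹ * H i j ∈ Set.Ici τ}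
        ≤ ENNReal.ofReal (C₂ * ρ ^ (-N)) := by
      have hsub : {H : Fin nR → Fin nT → ℝ | ¬ ∀ i j,
          (Real.exp (-(c.ν * c.d i j)))⁻¹ * H i j ∈ Set.Ici τ}
          ⊆ ⋃ i, ⋃ j, {H | H i j ∈ (fun y => (Real.exp (-(c.ν * c.d i j)))⁻¹ * y) ⁻¹' Set.Iio τ} := by
        intro H hH
        simp only [Set.mem_ofPred_eq, not_forall, Set.mem_Ici, not_le] at hH
        obtain ⟨i, j, hij⟩ := hH
        exact Set.mem_iUnion.2 ⟨i, Set.mem_iUnion.2 ⟨j, hij⟩⟩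
      refine (measure_mono hsub).trans ((measure_iUnion_fintype_le _ _).trans ?_)
      have hij : ∀ i j, c.lawH {H | H i j ∈ (fun y => (Real.exp (-(c.ν * c.d i j)))⁻¹ * y) ⁻¹' Set.Iio τ}
          ≤ ENNReal.ofReal ((K i j : ℝ) * C₁ * ρ ^ (-N)) := by
        intro i j
        have hms : MeasurableSet ((fun y => (Real.exp (-(c.ν * c.d i j)))⁻¹ * y) ⁻¹' Set.Iio τ) :=
          (measurable_const_mul _) measurableSet_Iio
        refine (hK i j _ hms).trans ?_
        rw [Channel.entryLaw, Measure.map_apply (measurable_const_mul _) hms]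
        have e1 : (fun x => Real.exp (-(c.ν * c.d i j)) * x) ⁻¹'
            ((fun y => (Real.exp (-(c.ν * c.d i j)))⁻¹ * y) ⁻¹' Set.Iio τ) = Set.Iio τ := by
          ext x
          simp
        rw [e1, ht, mul_assoc, ENNReal.ofReal_mul (K i j).coe_nonneg, ENNReal.ofReal_coe_nnreal]
        have e2 : τ ^ (N / ε) = ρ ^ (-N) := by
          rw [hτ, ← Real.rpow_mul hρ0.le]
          congr 1
          field_simp
        rw [← e2]
        exact mul_le_mul_right (h₁ τ hτ0 hτ1) _
      calc _ ≤ ∑ i, ∑ j, ENNReal.ofReal ((K i j : ℝ) * C₁ * ρ ^ (-N)) :=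
            Finset.sum_le_sum fun i _ => (measure_iUnion_fintype_le _ _).trans
              (Finset.sum_le_sum fun j _ => hij i j)
        _ = ENNReal.ofReal (C₂ * ρ ^ (-N)) := by
            have hnn : ∀ i j, 0 ≤ (K i j : ℝ) * C₁ * ρ ^ (-N) := fun i j => by positivity
            simp_rw [← ENNReal.ofReal_sum_of_nonneg fun j _ => hnn _ j]
            rw [← ENNReal.ofReal_sum_of_nonneg fun i _ => Finset.sum_nonneg fun j _ => hnn i j, hC₂]
            simp_rw [Finset.sum_mul]
    have hsplit : S ⊆ (S ∩ {H | ∀ i j, (Real.exp (-(c.ν * c.d i j)))⁻¹ * H i j ∈ Set.Ici τ}) ∪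
        {H | ¬ ∀ i j, (Real.exp (-(c.ν * c.d i j)))⁻¹ * H i j ∈ Set.Ici τ} := by
      intro H hH
      by_cases hb : ∀ i j, (Real.exp (-(c.ν * c.d i j)))⁻¹ * H i j ∈ Set.Ici τ
      · exact Or.inl ⟨hH, hb⟩
      · exact Or.inr hb
    refine (measure_mono hsplit).trans ((measure_union_le _ _).trans (add_le_add ?_ ?_))
    · exact hmain.trans (mul_le_mul_left (ENNReal.ofReal_le_ofReal hCpow) _)
    · refine hbad.trans (ENNReal.ofReal_le_ofReal ?_)
      refine mul_le_mul_of_nonneg_right ?_ (by positivity)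
      have : 0 ≤ (C₀ / s) ^ (nR * nT) := by positivity
      linarith

theorem entryLaw_absolutelyContinuous (c : Channel nR nT) (i : Fin nR) (j : Fin nT) :
    c.entryLaw i j ≪ volume := by
  have h1 : c.turbulence.law ≪ volume :=
    (withDensity_absolutelyContinuous _ _).trans Measure.absolutelyContinuous_restrict
  refine (h1.map (measurable_const_mul (Real.exp (-(c.ν * c.d i j))))).trans ?_
  rw [Real.map_volume_mul_left (Real.exp_ne_zero _)]
  exact Measure.smul_absolutelyContinuous

theorem ae_eig_pos (c : Channel nR nT) (hn : nR ≤ nT) : ∀ᵐ H ∂c.lawH, ∀ i, 0 < eig H i := by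
  have h := ae_linearIndependent hn (fun i => Measure.pi (c.entryLaw i)) fun i =>
    pi_absolutelyContinuous (entryLaw_absolutelyContinuous c i)
  filter_upwards [h] with H hH i
  exact eig_pos hH i

end Scaling

end OWC

namespace OWC

/-! ### Calculus of exponents in the extended reals -/

section Exponents

theorem eventually_mul_rpow_le {a b : ℝ} (hab : a < b) (C : ℝ) :
    ∀ᶠ ρ : ℝ in atTop, C * ρ ^ a ≤ ρ ^ b / 2 := by
  have h : ∀ᶠ ρ : ℝ in atTop, 2 * C ≤ ρ ^ (b - a) :=
    (tendsto_rpow_atTop (sub_pos.2 hab)).eventually_ge_atTop _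
  filter_upwards [h, eventually_gt_atTop 0] with ρ h1 h0
  have h2 : ρ ^ b = ρ ^ (b - a) * ρ ^ a := by rw [← Real.rpow_add h0]; congr 1; ring
  have := Real.rpow_pos_of_pos h0 a
  rw [h2]
  nlinarith

theorem exponent_le_coe_iff {g : ℝ → ℝ≥0∞} {ρ : ℝ} (hρ : 1 < ρ) (b : ℝ) :
    exponent g ρ ≤ (b : EReal) ↔ g ρ ≤ ENNReal.ofReal (ρ ^ b) := by
  have hl : 0 < Real.log ρ := Real.log_pos hρ
  have hρ0 : 0 < ρ := one_pos.trans hρ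
  rw [exponent, EReal.div_le_iff_le_mul (by exact_mod_cast hl) (EReal.coe_ne_top _),
    ← ENNReal.log_le_log_iff, ENNReal.log_ofReal_of_pos (Real.rpow_pos_of_pos hρ0 b),
    Real.log_rpow hρ0, ← EReal.coe_mul, mul_comm]

theorem limsup_exponent_le {f : ℝ → ℝ≥0∞} {L : EReal}
    (h : ∀ b : ℝ, L < b → ∀ᶠ ρ in atTop, f ρ ≤ ENNReal.ofReal (ρ ^ b)) :
    limsup (exponent f) atTop ≤ L := by
  refine EReal.le_of_forall_lt_iff_le.1 fun b hb => ?_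
  refine limsup_le_of_le (by isBoundedDefault) ?_
  filter_upwards [h b hb, eventually_gt_atTop 1] with ρ h1 hρ
  exact (exponent_le_coe_iff hρ b).2 h1

theorem eventually_le_rpow {g : ℝ → ℝ≥0∞} {b : ℝ} (h : limsup (exponent g) atTop < b) :
    ∀ᶠ ρ in atTop, g ρ ≤ ENNReal.ofReal (ρ ^ b) := by
  filter_upwards [eventually_lt_of_limsup_lt h, eventually_gt_atTop 1] with ρ h1 hρ
  exact (exponent_le_coe_iff hρ b).1 h1.le

/-- The factor ρ^δ costs only δ in the exponent, and ρ^(-N) drops below any prescribed power; the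
constant may depend on δ and N. The arbitrary N covers right-hand exponents equal to -∞. -/
theorem limsup_exponent_le_limsup_exponent {f g : ℝ → ℝ≥0∞}
    (h : ∀ δ N : ℝ, 0 < δ → 0 < N → ∃ C : ℝ, 0 < C ∧ ∀ᶠ ρ in atTop,
      f ρ ≤ ENNReal.ofReal (C * ρ ^ δ) * g ρ + ENNReal.ofReal (C * ρ ^ (-N))) :
    limsup (exponent f) atTop ≤ limsup (exponent g) atTop := by
  refine limsup_exponent_le fun b hb => ?_
  obtain ⟨b', hb', hbb⟩ := EReal.lt_iff_exists_real_btwn.1 hb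
  have hbb' : b' < b := by exact_mod_cast hbb
  -- Half the gap between b' and b remains to absorb C, and -(|b| + 1) < b; each of the two terms
  -- then ends below ρ^b/2.
  obtain ⟨C, hC, hev⟩ := h ((b - b') / 2) (|b| + 1) (by linarith) (by positivity)
  filter_upwards [hev, eventually_le_rpow hb', eventually_gt_atTop 0,
    eventually_mul_rpow_le (show (b - b') / 2 + b' < b by linarith) C,
    eventually_mul_rpow_le (show -(|b| + 1) < b by linarith [neg_abs_le b]) C]
    with ρ h1 h2 h0 h3 h4
  have hp : 0 ≤ ρ ^ ((b - b') / 2) := (Real.rpow_pos_of_pos h0 _).le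
  calc f ρ ≤ _ := h1
    _ ≤ ENNReal.ofReal (C * ρ ^ ((b - b') / 2)) * ENNReal.ofReal (ρ ^ b')
        + ENNReal.ofReal (C * ρ ^ (-(|b| + 1))) := by gcongr
    _ = ENNReal.ofReal (C * ρ ^ ((b - b') / 2 + b') + C * ρ ^ (-(|b| + 1))) := by
        rw [← ENNReal.ofReal_mul (by positivity), mul_assoc, ← Real.rpow_add h0,
          ← ENNReal.ofReal_add (by positivity) (by positivity)]
    _ ≤ ENNReal.ofReal (ρ ^ b) := ENNReal.ofReal_le_ofReal (by linarith)

theorem limsup_exponent_add_le {g₁ g₂ : ℝ → ℝ≥0∞} {L : EReal}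
    (h₁ : limsup (exponent g₁) atTop ≤ L) (h₂ : limsup (exponent g₂) atTop ≤ L) :
    limsup (exponent fun ρ => g₁ ρ + g₂ ρ) atTop ≤ L := by
  refine limsup_exponent_le fun b hb => ?_
  obtain ⟨b', hb', hbb⟩ := EReal.lt_iff_exists_real_btwn.1 hb
  have hbb' : b' < b := by exact_mod_cast hbb
  filter_upwards [eventually_le_rpow (h₁.trans_lt hb'), eventually_le_rpow (h₂.trans_lt hb'),
    eventually_gt_atTop 0, eventually_mul_rpow_le hbb' 1] with ρ e₁ e₂ h0 h3
  have hp : 0 ≤ ρ ^ b' := (Real.rpow_pos_of_pos h0 _).le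
  have hpb : 0 ≤ ρ ^ b := (Real.rpow_pos_of_pos h0 _).le
  refine (add_le_add e₁ e₂).trans ?_
  rw [← ENNReal.ofReal_add hp hp]
  exact ENNReal.ofReal_le_ofReal (by linarith)

theorem exponent_osnrPow {ρ : ℝ} (hρ : 1 < ρ) (e : EReal) :
    exponent (fun ρ => osnrPow ρ e) ρ = e := by
  have hl : 0 < Real.log ρ := Real.log_pos hρ
  rw [exponent, osnrPow, EReal.log_exp, ← EReal.mul_div_right,
    EReal.div_mul_cancel (EReal.coe_ne_bot _) (EReal.coe_ne_top _) (by exact_mod_cast hl.ne')]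

theorem exponent_mono {f g : ℝ → ℝ≥0∞} {ρ : ℝ} (hρ : 1 < ρ) (h : f ρ ≤ g ρ) :
    exponent f ρ ≤ exponent g ρ :=
  EReal.div_le_div_right_of_nonneg (by exact_mod_cast (Real.log_pos hρ).le) (ENNReal.log_le_log h)

theorem le_liminf_exponent_osnrPow_add (e₁ e₂ : EReal) :
    max e₁ e₂ ≤ liminf (exponent fun ρ => osnrPow ρ e₁ + osnrPow ρ e₂) atTop := by
  refine le_liminf_of_le (by isBoundedDefault) ?_
  filter_upwards [eventually_gt_atTop 1] with ρ hρ
  refine max_le ?_ ?_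
  · exact (exponent_osnrPow hρ e₁).symm.le.trans (exponent_mono hρ le_self_add)
  · exact (exponent_osnrPow hρ e₂).symm.le.trans (exponent_mono hρ le_add_self)

end Exponents

/-! ### Comparison of the error probability with outage and J -/

section RandomCoding

open Matrix

variable {nR nT : ℕ}

theorem gramDet_smul (ρ s : ℝ) (H : Fin nR → Fin nT → ℝ) :
    gramDet ρ (fun i j => s * H i j) = gramDet (s * ρ) H := by
  have : of (fun i j => s * H i j) = s • of H := by ext i j; simp
  rw [gramDet, gramDet, this, transpose_smul, Matrix.smul_mul, Matrix.mul_smul, smul_smul, smul_smul]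
  congr 3
  ring

/-- If some scaled eigenvalue s²ρ²λ is at least 1, its factor obeys 1 + s²ρ²λ ≤ 2s²(1 + ρ²λ) and the
others do not grow; otherwise every factor is below 2. A dilation thus lowers log D by any desired
constant unless D is bounded. -/
theorem gramDet_mul_le (ρ : ℝ) {s : ℝ} (hs1 : s ^ 2 ≤ 1) (H : Fin nR → Fin nT → ℝ) :
    gramDet (s * ρ) H ≤ max (2 ^ nR) (2 * s ^ 2 * gramDet ρ H) := by
  have ht : ∀ i, 0 ≤ ρ ^ 2 * eig H i := fun i => mul_nonneg (sq_nonneg ρ) (eig_nonneg H i)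
  have hst : ∀ i, 0 ≤ s ^ 2 * (ρ ^ 2 * eig H i) := fun i => mul_nonneg (sq_nonneg s) (ht i)
  have e : gramDet (s * ρ) H = ∏ i, (1 + s ^ 2 * (ρ ^ 2 * eig H i)) := by
    rw [gramDet_eq_prod]
    refine Finset.prod_congr rfl fun i _ => ?_
    ring
  rw [e]
  by_cases h : ∃ i, 1 ≤ s ^ 2 * (ρ ^ 2 * eig H i)
  · obtain ⟨i, hi⟩ := h
    refine le_max_of_le_right ?_
    rw [gramDet_eq_prod,
      ← Finset.mul_prod_erase _ (fun k => 1 + s ^ 2 * (ρ ^ 2 * eig H k)) (Finset.mem_univ i),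
      ← Finset.mul_prod_erase _ (fun k => 1 + ρ ^ 2 * eig H k) (Finset.mem_univ i),
      ← mul_assoc (2 * s ^ 2)]
    refine mul_le_mul ?_ (Finset.prod_le_prod (fun k _ => by linarith [hst k]) fun k _ => ?_)
      (Finset.prod_nonneg fun k _ => by linarith [hst k]) ?_
    · nlinarith [sq_nonneg s]
    · nlinarith [ht k]
    · have := ht i
      positivity
  · push Not at h
    refine le_max_of_le_left ?_
    calc ∏ i, (1 + s ^ 2 * (ρ ^ 2 * eig H i)) ≤ ∏ _i : Fin nR, (2 : ℝ) :=
          Finset.prod_le_prod (fun i _ => by linarith [hst i]) fun i _ => by linarith [h i]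
      _ = 2 ^ nR := by simp

/-- Positivity of the eigenvalues is essential: λ = 0 would get a = 0 from the default value of the
logarithm, hence (2 - a)⁺ = 2 against log 1 = 0. It holds almost surely by `ae_eig_pos`. -/
theorem integrand_ge {l : ℕ} {C r ρ : ℝ} (hC : 0 < C) (hρ : 1 < ρ) {H : Fin nR → Fin nT → ℝ}
    (hH : ∀ i, 0 < eig H i) :
    ρ ^ ((l : ℝ) * r) * (C / √(gramDet ρ H)) ^ l
      ≤ C ^ l * ρ ^ (-((l : ℝ) / 2) * (∑ i, max 0 (2 - expo ρ H i) - 2 * r)) := by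
  have hρ0 : 0 < ρ := one_pos.trans hρ
  have hD : 0 < gramDet ρ H := one_pos.trans_le (one_le_gramDet ρ H)
  have hterm : ∀ i, max 0 (2 - expo ρ H i) ≤ Real.logb ρ (1 + ρ ^ 2 * eig H i) := by
    intro i
    have h1 : 0 < ρ ^ 2 * eig H i := mul_pos (by positivity) (hH i)
    refine max_le (Real.logb_nonneg hρ (by linarith)) ?_
    have h2 : 2 - expo ρ H i = Real.logb ρ (ρ ^ 2 * eig H i) := by
      rw [Real.logb_mul (by positivity) (hH i).ne', Real.logb_pow,
        Real.logb_self_eq_one hρ, expo]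
      push_cast
      ring
    rw [h2]
    exact Real.logb_le_logb_of_le hρ h1 (by linarith)
  have hsum : ∑ i, max 0 (2 - expo ρ H i) ≤ Real.logb ρ (gramDet ρ H) := by
    rw [gramDet_eq_prod, Real.logb_prod _ _ fun i _ => by
      have := mul_pos (by positivity : 0 < ρ ^ 2) (hH i)
      positivity]
    exact Finset.sum_le_sum fun i _ => hterm i
  have hpow : (√(gramDet ρ H))⁻¹ ^ l = ρ ^ (-((l : ℝ) / 2) * Real.logb ρ (gramDet ρ H)) := by
    rw [mul_comm, Real.rpow_mul hρ0.le, Real.rpow_logb hρ0 hρ.ne' hD, Real.sqrt_eq_rpow,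
      ← Real.rpow_neg hD.le, ← Real.rpow_natCast, ← Real.rpow_mul hD.le]
    congr 1
    ring
  rw [div_eq_mul_inv, mul_pow, hpow, mul_left_comm, ← Real.rpow_add hρ0]
  refine mul_le_mul_of_nonneg_left (Real.rpow_le_rpow_of_exponent_le hρ.le ?_) (by positivity)
  have hl : (0 : ℝ) ≤ (l : ℝ) / 2 := by positivity
  have := mul_le_mul_of_nonneg_left hsum hl
  linarith

theorem unionTerm_le (c : Channel nR nT) (hn : nR ≤ nT) {l : ℕ} {m r ρ C : ℝ} (hC : 0 < C)
    (hρ : 1 < ρ) {S : Set (Fin nR → Fin nT → ℝ)} (hS : c.outageSet m r ρ ⊆ S) :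
    ENNReal.ofReal (ρ ^ ((l : ℝ) * r)) *
        ∫⁻ H in Sᶜ, ENNReal.ofReal ((C / √(gramDet ρ H)) ^ l) ∂c.lawH
      ≤ ENNReal.ofReal (C ^ l) * c.teIntegral l m r ρ := by
  have hρ0 : 0 < ρ := one_pos.trans hρ
  rw [← lintegral_const_mul' _ _ ENNReal.ofReal_ne_top, Channel.teIntegral,
    ← lintegral_const_mul' _ _ ENNReal.ofReal_ne_top]
  refine (lintegral_mono_set (Set.compl_subset_compl.2 hS)).trans (lintegral_mono_ae ?_)
  filter_upwards [ae_restrict_of_ae (ae_eig_pos c hn)] with H hH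
  rw [← ENNReal.ofReal_mul (by positivity), ← ENNReal.ofReal_mul (by positivity)]
  exact ENNReal.ofReal_le_ofReal (integrand_ge hC hρ hH)

theorem Pe_le_Pout_add (c : Channel nR nT) (hn : nR ≤ nT) (l : ℕ) (m : ℝ) {r : ℝ} (hr : 0 ≤ r)
    {δ N : ℝ} (hδ : 0 < δ) (hN : 0 < N) : ∃ C : ℝ, 0 < C ∧ ∀ᶠ ρ in atTop,
      ∀ dec : Decoder nR nT l (codeSize l r ρ), c.IsML dec → c.Pe l m r ρ dec ≤
        ENNReal.ofReal (C * ρ ^ δ) * (c.Pout r ρ + c.teIntegral l m r ρ)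
          + ENNReal.ofReal (C * ρ ^ (-N)) := by
  obtain ⟨C₁, hC₁, hPe⟩ := Pe_le c l m
  have absorb : ∀ {B C₀ ρ : ℝ}, C₀ ≤ B → 0 ≤ C₀ → 1 < ρ →
      ENNReal.ofReal C₀ ≤ ENNReal.ofReal (B * ρ ^ δ) := by
    intro B C₀ ρ hB h0 hρ
    exact ENNReal.ofReal_le_ofReal (hB.trans
      (le_mul_of_one_le_right (h0.trans hB) (Real.one_le_rpow hρ.le hδ.le)))
  -- At r = 0 the threshold R does not grow, so bounded D could not be treated below; but then the
  -- truncated exponential outage set is empty and J alone suffices.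
  rcases hr.eq_or_lt with rfl | hr
  · refine ⟨C₁ ^ l, by positivity, ?_⟩
    filter_upwards [eventually_gt_atTop 1] with ρ hρ dec hdec
    have hout : c.outageSet m 0 ρ ⊆ ∅ := by
      intro H hH
      have hH' : c.mutualInfo (c.teInput m ρ) H < rate 0 ρ := hH
      simp [rate] at hH'
    refine (hPe ρ (one_pos.trans hρ) 0 dec hdec ∅ MeasurableSet.empty).trans ?_
    rw [measure_empty, zero_add]
    refine (unionTerm_le c hn hC₁ hρ hout).trans (le_add_right ?_)
    exact mul_le_mul' (absorb le_rfl (by positivity) hρ) le_add_self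
  · obtain ⟨K₁, hK₁⟩ := le_mutualInfo_teInput c m
    obtain ⟨K₂, hK₂⟩ := mutualInfo_le c
    -- Chosen so that log(2s²) ≤ -2(|K₁| + |K₂|), which pays for the gap between the two mutual
    -- information bounds.
    set s : ℝ := Real.exp (-(|K₁| + |K₂|)) / 2 with hs
    have hs0 : 0 < s := by positivity
    have hexp1 : Real.exp (-(|K₁| + |K₂|)) ≤ 1 := Real.exp_le_one_iff.2 (by
      have := abs_nonneg K₁; have := abs_nonneg K₂; linarith)
    have hs1 : s < 1 := by rw [hs]; linarith
    obtain ⟨C₂, hC₂, hdil⟩ := lawH_dilation_le c hs0 hs1 hδ hN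
    refine ⟨C₁ ^ l + C₂, by positivity, ?_⟩
    -- Takes care of the channels with D ≤ 2^nR, which are in outage for every admissible input once
    -- ρ is large.
    have hlarge : ∀ᶠ ρ : ℝ in atTop, (nR * Real.log 2) / 2 + K₂ ≤ r * Real.log ρ :=
      (Real.tendsto_log_atTop.const_mul_atTop hr).eventually_ge_atTop _
    filter_upwards [eventually_gt_atTop 1, hlarge] with ρ hρ hbig dec hdec
    have hρ0 : 0 < ρ := one_pos.trans hρ
    set R := r * Real.log ρ with hR
    -- An explicit measurable set containing the outage set, whose own measurability is thus not
    -- needed.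
    set S : Set (Fin nR → Fin nT → ℝ) := {H | Real.log (gramDet ρ H) < 2 * (R + K₁)} with hS
    have hSm : MeasurableSet S :=
      measurableSet_lt (Real.measurable_log.comp (continuous_gramDet ρ).measurable) measurable_const
    have hD : ∀ (ρ : ℝ) (H : Fin nR → Fin nT → ℝ), 0 < gramDet ρ H := fun ρ H =>
      one_pos.trans_le (one_le_gramDet ρ H)
    have hout : c.outageSet m r ρ ⊆ S := by
      intro H hH
      have hH' : c.mutualInfo (c.teInput m ρ) H < ENNReal.ofReal R := hH
      have h1 := (ENNReal.ofReal_lt_ofReal_iff'.1 ((hK₁ ρ hρ0 H).trans_lt hH')).1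
      change Real.log (gramDet ρ H) < 2 * (R + K₁)
      linarith
    -- The dilated set lies in the outage event of every admissible p, so the bound survives the
    -- infimum over p.
    have hT : c.lawH ((fun H i j => s⁻¹ * H i j) ⁻¹' S) ≤ c.Pout r ρ := by
      refine le_iInf fun p => le_iInf fun hp => measure_mono fun H hH => ?_
      have hH' : Real.log (gramDet (s⁻¹ * ρ) H) < 2 * (R + K₁) := by
        rw [← gramDet_smul]; exact hH
      have h1 := gramDet_mul_le (s⁻¹ * ρ) (s := s) (by nlinarith) H
      rw [mul_inv_cancel_left₀ hs0.ne'] at h1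
      have h2 : Real.log (gramDet ρ H) / 2 + K₂ ≤ R := by
        rcases le_max_iff.1 h1 with h1 | h1
        · have := Real.log_le_log (hD ρ H) h1
          rw [Real.log_pow] at this
          linarith
        · have h3 := Real.log_le_log (hD ρ H) h1
          rw [Real.log_mul (by positivity) (hD _ H).ne'] at h3
          have h4 : Real.log (2 * s ^ 2) ≤ -(2 * (|K₁| + |K₂|)) := by
            rw [Real.log_le_iff_le_exp (by positivity), hs]
            have h5 : Real.exp (-(2 * (|K₁| + |K₂|))) = Real.exp (-(|K₁| + |K₂|)) ^ 2 := by
              rw [← Real.exp_nat_mul]; congr 1; push_cast; ring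
            rw [h5]
            nlinarith [sq_nonneg (Real.exp (-(|K₁| + |K₂|)))]
          have := le_abs_self K₁
          have := le_abs_self K₂
          linarith
      change c.mutualInfo p H ≤ rate r ρ
      exact (hK₂ ρ hρ0 p hp H).trans (ENNReal.ofReal_le_ofReal h2)
    have hpδ : 0 ≤ ρ ^ δ := (Real.rpow_pos_of_pos hρ0 _).le
    have hpN : 0 ≤ ρ ^ (-N) := (Real.rpow_pos_of_pos hρ0 _).le
    have hCl : 0 ≤ C₁ ^ l := by positivity
    calc c.Pe l m r ρ dec ≤ c.lawH S + ENNReal.ofReal (ρ ^ ((l : ℝ) * r)) *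
        ∫⁻ H in Sᶜ, ENNReal.ofReal ((C₁ / √(gramDet ρ H)) ^ l) ∂c.lawH := hPe ρ hρ0 r dec hdec S hSm
      _ ≤ (ENNReal.ofReal (C₂ * ρ ^ δ) * c.Pout r ρ + ENNReal.ofReal (C₂ * ρ ^ (-N)))
          + ENNReal.ofReal (C₁ ^ l) * c.teIntegral l m r ρ :=
          add_le_add ((hdil ρ hρ.le S hSm).trans (add_le_add (mul_le_mul_right hT _) le_rfl))
            (unionTerm_le c hn hC₁ hρ hout)
      _ ≤ (ENNReal.ofReal ((C₁ ^ l + C₂) * ρ ^ δ) * c.Pout r ρ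
            + ENNReal.ofReal ((C₁ ^ l + C₂) * ρ ^ (-N)))
          + ENNReal.ofReal ((C₁ ^ l + C₂) * ρ ^ δ) * c.teIntegral l m r ρ := by
          refine add_le_add (add_le_add (mul_le_mul_left (ENNReal.ofReal_le_ofReal ?_) _)
            (ENNReal.ofReal_le_ofReal ?_)) (mul_le_mul_left (absorb (by linarith) hCl hρ) _)
          · exact mul_le_mul_of_nonneg_right (by linarith) hpδ
          · exact mul_le_mul_of_nonneg_right (by linarith) hpN
      _ = _ := by ring

end RandomCoding

end OWC

theorem mainTheorem5 {nR nT l : ℕ} (hnR : 0 < nR) (hn : nR ≤ nT) (hl : 0 < l)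
    (c : OWC.Channel nR nT) (m : ℝ) (hm : OWC.truncExpMean m = c.α / nT)
    (r : ℝ) (hr : 0 ≤ r)
    (δ : ∀ ρ : ℝ, OWC.Decoder nR nT l (OWC.codeSize l r ρ)) (hδ : ∀ ρ, c.IsML (δ ρ)) :
    limsup (OWC.exponent fun ρ => c.Pe l m r ρ (δ ρ)) atTop ≤
        limsup (OWC.exponent fun ρ => c.Pout r ρ + c.teIntegral l m r ρ) atTop ∧
      ∀ dout dte : EReal,
        OWC.ExpEq (c.Pout r) (-dout) → OWC.ExpEq (c.teIntegral l m r) (-dte) →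
          OWC.ExpLE (fun ρ => c.Pe l m r ρ (δ ρ))
            (fun ρ => OWC.osnrPow ρ (-dout) + OWC.osnrPow ρ (-dte)) := by
  have main : limsup (OWC.exponent fun ρ => c.Pe l m r ρ (δ ρ)) atTop ≤
      limsup (OWC.exponent fun ρ => c.Pout r ρ + c.teIntegral l m r ρ) atTop := by
    refine OWC.limsup_exponent_le_limsup_exponent fun ε N hε hN => ?_
    obtain ⟨C, hC, h⟩ := OWC.Pe_le_Pout_add c hn l m hr hε hN
    exact ⟨C, hC, h.mono fun ρ hρ => hρ (δ ρ) (hδ ρ)⟩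
  refine ⟨main, fun dout dte h₁ h₂ => ?_⟩
  refine le_trans (main.trans (OWC.limsup_exponent_add_le ?_ ?_))
    (OWC.le_liminf_exponent_osnrPow_add (-dout) (-dte))
  · exact (Tendsto.limsup_eq h₁).le.trans (le_max_left _ _)
  · exact (Tendsto.limsup_eq h₂).le.trans (le_max_right _ _)
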